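/- **The language.** Terms and formulas are generated as follows. The names (noemata) $v_0,v_1,\dots$, the truth constant $\mathrm T$ and the enumeration constant € are terms; if $a,b$ are terms, then $a\in b$ is a formula and $\downarrow ab$ is a term; if $A,B$ are formulas, then $\downarrow AB$ is a formula, $\forall y A$ is a formula and $\{y\mid A\}$ is a term. Expressions are taken up to renaming of bound variables. Free noemata are names, not variables. A *cognomen* is a term, and a *proposition* a formula, in which no noema is free. Connectives and $\exists$ are defined classically from $\downarrow$ ("neither-nor") and $\forall$; further $a=b:\equiv\forall u(a\in u\to b\in u)$; $\mathbb T A:\equiv\exists y\,(y\in\{y\mid A\})$ with $y$ not free in $A$; $\mathrm{KIND}(a):\equiv\forall x(\mathbb T\,x\in a\vee\mathbb T\,x\notin a)$; $\langle a,b\rangle$ is the Kuratowski pair; $\underline 0=\{x\mid x\ne x\}$, $\underline{n+1}=\{x\mid x\in\underline n\vee x=\underline n\}$; and $\mathbb N=\{x\mid\forall y(\underline 0\in y\wedge\forall z(z\in y\to z\cup\{z\}\in y)\to x\in y)\}$, where $z\cup\{z\}$ stands for $\{w\mid w\in z\vee w=z\}$. Expressions are numbered injectively by reading their Polish notation as a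 binary numeral, and $\ulcorner A\urcorner$ is the numeral $\underline m$ of the number $m$ of $A$. *Variants.* Two propositions are variants if they are related by a finite chain of steps, each of which passes to a classically equivalent proposition or replaces a cognomen in it by a variant. Variant cognomina are: $\mathrm T$ and itself; € and itself; $\downarrow ab$ and $\downarrow cd$ when $a,b$ are variants of $c,d$ in one of the two orders; $\{x\mid A(x)\}$ and $\{y\mid B(y)\}$ when $A(d)$ and $B(d)$ are variants for every cognomen $d$. Let $e_n$ be the cognomen with the smallest number that is not a variant of any of $e_0,\dots,e_{n-1}$. **The semantic process.** By recursion on ordinals $\alpha$ one defines $\alpha\vDash A$; below, $a,b,c$ are cognomina unless otherwise said. Say that $A$ is *settled* at $\alpha$ if there is $\beta<\alpha$ with $\gamma\vDash A$ for all $\beta\le\gamma<\alpha$. Let $a=_\alpha b$ mean that for every $B(u)$ without further noemata, $B(a)$ is settled at $\alpha$ iff $B(b)$ is; this is the same as $\alpha\vDash a=b$. At stage $\alpha$, $v_0$ names $e_0$, and $v_{n+1}$ names $e_{n+1}$ if $e_{n+1}\neq_\alpha$ every cognomen named by $v_0,\dots,v_n$, and otherwise names what $v_n$ names. Then - $\alpha\vDash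 a\in\{u\mid A\}$ iff $A(a/u)$ is settled at $\alpha$; - $\alpha\vDash\ \downarrow AB$ iff neither $\alpha\vDash A$ nor $\alpha\vDash B$; - $\alpha\vDash a\in\ \downarrow bc$ iff neither $\alpha\vDash a\in b$ nor $\alpha\vDash a\in c$; - $\alpha\vDash\forall yA$ iff $\alpha\vDash A(a/y)$ for every cognomen $a$; - $\alpha\vDash a\in\mathrm T$ iff $a=_\alpha\ulcorner A\urcorner$ and $\alpha\vDash\mathbb T A$ for some formula $A$; - $\alpha\vDash a\in$ € iff for some $n$ and some cognomen $b$, $a=_\alpha\langle\underline n,b\rangle$ and $b$ is $=_\alpha$ to what $v_n$ names at $\alpha$; - a formula containing noemata holds at $\alpha$ iff it holds when each noema is replaced by what it names at $\alpha$. Let $\vDash_\gamma=\{A\mid\gamma\vDash\mathbb T A\}$. A formula is in $IN$ (in $OUT$) if it belongs (does not belong) to $\vDash_\gamma$ for all sufficiently large $\gamma$, and is unstable if it is in neither. A limit ordinal $\kappa$ *covers* the process if, for all $\gamma\ge\kappa$, $IN\subseteq\vDash_\gamma$ and every member of $\vDash_\gamma$ is in $IN$ or unstable; it *stabilizes* the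 process if moreover $\vDash_\kappa\subseteq IN$. Let $\kappa_0$ be the least stabilizing ordinal. A formula $A$ is a *maxim*, $\Vdash A$, if $\kappa_0\vDash\mathbb T A$. A term $a$ *is a kind* if $\Vdash\mathrm{KIND}(a)$. **The order.** $a\lhd b:\equiv\exists x\exists y(x\in\mathbb N\wedge y\in\mathbb N\wedge\langle x,a\rangle\in$ €$\ \wedge\langle y,b\rangle\in$ €$\ \wedge x<y)$, where $<$ is the usual order of von Neumann numbers, i.e. $\in$; and $a\unlhd b:\equiv a\lhd b\vee a=b$. The *librationist capture* term of a term $a$ and a condition $\varphi$ is $\{x\mid\exists y(y\in a\wedge\varphi(y,x)\wedge\forall z(\varphi(y,z)\to x\unlhd z))\}$. **Proposition (Librationist capture of choice).** Let $c$ be a term such that $c$ is a kind, and such that it is a maxim that every member of $c$ is a nonempty kind, $\Vdash\forall y(y\in c\to\mathrm{KIND}(y)\wedge\exists x\,x\in y)$, and a maxim that any two members of $c$ that are not coextensional have empty intersection, $\Vdash\forall y\forall z(y\in c\wedge z\in c\wedge\neg\forall u(u\in y\leftrightarrow u\in z)\to\neg\exists x(x\in y\wedge x\in z))$. Let $$S=\{x\mid\exists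 y(y\in c\wedge x\in y\wedge\forall z(z\in y\to x\unlhd z))\},$$ the librationist capture term of $c$ and the condition $x\in y$. Then $S$ is a kind, and it is a maxim that $S$ contains precisely one element of each member of $c$, up to identity and hence up to coextensionality: $$\Vdash\forall y\bigl(y\in c\to\exists x\bigl(x\in S\wedge x\in y\wedge\forall z(z\in S\wedge z\in y\to z=x\wedge\forall u(u\in z\leftrightarrow u\in x))\bigr)\bigr).$$ In particular it is a maxim that there is a kind $w$ that contains, in this sense, precisely one element of each member of $c$. -/

import Mathlib

namespace Libra

/-! ## The language

Bound variables are de Bruijn indices, so that expressions are taken up to renaming of bound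
variables and substitution never captures. The noemata are the names `v₀, v₁, …`. `Tm k` and
`Fm k` are the terms and formulas whose dangling bound variables are among `0, …, k - 1`; the terms
and formulas of the language are those of `Tm 0` and `Fm 0`. -/

mutual
  /-- Terms. -/
  inductive Tm : ℕ → Type
    | bound {k : ℕ} (i : Fin k) : Tm k
    | noema {k : ℕ} (n : ℕ) : Tm k
    | alethizor {k : ℕ} : Tm k
    | enumerator {k : ℕ} : Tm k
    | junct {k : ℕ} (a b : Tm k) : Tm k
    | abs {k : ℕ} (A : Fm (k + 1)) : Tm k
  /-- Formulas. The atomic formula `app b a` is the concatenation `ba`, read "`a ∈ b`". -/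
  inductive Fm : ℕ → Type
    | app {k : ℕ} (b a : Tm k) : Fm k
    | joint {k : ℕ} (A B : Fm k) : Fm k
    | all {k : ℕ} (A : Fm (k + 1)) : Fm k
end

/-- The renaming under a binder. -/
def upr {k m : ℕ} (f : Fin k → Fin m) : Fin (k + 1) → Fin (m + 1) :=
  Fin.cons 0 (fun i => (f i).succ)

mutual
  /-- Renaming of dangling bound variables. -/
  def Tm.rename : {k m : ℕ} → Tm k → (Fin k → Fin m) → Tm m
    | _, _, .bound i, f => .bound (f i)
    | _, _, .noema n, _ => .noema n
    | _, _, .alethizor, _ => .alethizor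
    | _, _, .enumerator, _ => .enumerator
    | _, _, .junct a b, f => .junct (a.rename f) (b.rename f)
    | _, _, .abs A, f => .abs (A.rename (upr f))
  /-- Renaming of dangling bound variables. -/
  def Fm.rename : {k m : ℕ} → Fm k → (Fin k → Fin m) → Fm m
    | _, _, .app b a, f => .app (b.rename f) (a.rename f)
    | _, _, .joint A B, f => .joint (A.rename f) (B.rename f)
    | _, _, .all A, f => .all (A.rename (upr f))
end

/-- The same term, inside one more binder. -/
def Tm.lift {k : ℕ} (a : Tm k) : Tm (k + 1) := a.rename Fin.succ

/-- The same formula, inside one more binder. -/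
def Fm.lift {k : ℕ} (A : Fm k) : Fm (k + 1) := A.rename Fin.succ

/-- The substitution under a binder. -/
def ups {k m : ℕ} (s : Fin k → Tm m) : Fin (k + 1) → Tm (m + 1) :=
  Fin.cons (.bound 0) (fun i => (s i).lift)

mutual
  /-- Simultaneous substitution for the dangling bound variables. -/
  def Tm.subst : {k m : ℕ} → Tm k → (Fin k → Tm m) → Tm m
    | _, _, .bound i, s => s i
    | _, _, .noema n, _ => .noema n
    | _, _, .alethizor, _ => .alethizor
    | _, _, .enumerator, _ => .enumerator
    | _, _, .junct a b, s => .junct (a.subst s) (b.subst s)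
    | _, _, .abs A, s => .abs (A.subst (ups s))
  /-- Simultaneous substitution for the dangling bound variables. -/
  def Fm.subst : {k m : ℕ} → Fm k → (Fin k → Tm m) → Fm m
    | _, _, .app b a, s => .app (b.subst s) (a.subst s)
    | _, _, .joint A B, s => .joint (A.subst s) (B.subst s)
    | _, _, .all A, s => .all (A.subst (ups s))
end

/-- `A(a/u)`, for a formula `A` with the one dangling variable `u`. -/
def Fm.inst (A : Fm 1) (a : Tm 0) : Fm 0 := A.subst (fun _ => a)

mutual
  /-- Replacing every noema `vₙ` by the term `r n`. -/
  def Tm.designate (r : ℕ → Tm 0) : {k : ℕ} → Tm k → Tm k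
    | _, .bound i => .bound i
    | _, .noema n => (r n).rename Fin.elim0
    | _, .alethizor => .alethizor
    | _, .enumerator => .enumerator
    | _, .junct a b => .junct (a.designate r) (b.designate r)
    | _, .abs A => .abs (A.designate r)
  /-- Replacing every noema `vₙ` by the term `r n`. -/
  def Fm.designate (r : ℕ → Tm 0) : {k : ℕ} → Fm k → Fm k
    | _, .app b a => .app (b.designate r) (a.designate r)
    | _, .joint A B => .joint (A.designate r) (B.designate r)
    | _, .all A => .all (A.designate r)
end

mutual
  /-- No noema is present in the term. A member of `Tm 0` with this property is a *cognomen*. -/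
  def Tm.NoNoema : {k : ℕ} → Tm k → Prop
    | _, .bound _ => True
    | _, .noema _ => False
    | _, .alethizor => True
    | _, .enumerator => True
    | _, .junct a b => a.NoNoema ∧ b.NoNoema
    | _, .abs A => A.NoNoema
  /-- No noema is present in the formula. A member of `Fm 0` with this property is a
  *proposition*. -/
  def Fm.NoNoema : {k : ℕ} → Fm k → Prop
    | _, .app b a => b.NoNoema ∧ a.NoNoema
    | _, .joint A B => A.NoNoema ∧ B.NoNoema
    | _, .all A => A.NoNoema
end

/-! ## Defined connectives and notions of the object language -/

section Defined
variable {k : ℕ}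

/-- `a ∈ b` -/
def Fm.mem (a b : Tm k) : Fm k := .app b a
/-- `¬ A` -/
def Fm.neg (A : Fm k) : Fm k := .joint A A
/-- `A ∨ B` -/
def Fm.or (A B : Fm k) : Fm k := .joint (.joint A B) (.joint A B)
/-- `A ∧ B` -/
def Fm.and (A B : Fm k) : Fm k := .joint (.joint A A) (.joint B B)
/-- `A → B` -/
def Fm.imp (A B : Fm k) : Fm k := .joint (.joint (.joint A A) B) (.joint (.joint A A) B)
/-- `A ↔ B` -/
def Fm.iff (A B : Fm k) : Fm k := (A.imp B).and (B.imp A)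
/-- `∃ y A` -/
def Fm.ex (A : Fm (k + 1)) : Fm k := (Fm.all A.neg).neg

/-- The truth operator `𝕋 A`, which is `∃ y (y ∈ {y | A})` with `y` not in `A`. -/
def Fm.tr (A : Fm k) : Fm k := Fm.ex (Fm.mem (.bound 0) (.abs A.lift.lift))

/-- Identity `a = b`, which is `∀ u (a ∈ u → b ∈ u)`. -/
def Fm.eq (a b : Tm k) : Fm k :=
  .all ((Fm.mem a.lift (.bound 0)).imp (Fm.mem b.lift (.bound 0)))

/-- Coextensionality: `∀ u (u ∈ a ↔ u ∈ b)`. -/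
def Fm.coext (a b : Tm k) : Fm k :=
  .all ((Fm.mem (.bound 0) a.lift).iff (Fm.mem (.bound 0) b.lift))

/-- `KIND(a)`, which is `∀ x (𝕋 x ∈ a ∨ 𝕋 x ∉ a)`. -/
def Fm.kind (a : Tm k) : Fm k :=
  .all ((Fm.mem (.bound 0) a.lift).tr.or (Fm.mem (.bound 0) a.lift).neg.tr)

/-- The unordered pair `{x | x = a ∨ x = b}`. -/
def Tm.upair (a b : Tm k) : Tm k :=
  .abs ((Fm.eq (.bound 0) a.lift).or (Fm.eq (.bound 0) b.lift))

/-- The singleton `{x | x = a}`. -/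
def Tm.single (a : Tm k) : Tm k := .abs (Fm.eq (.bound 0) a.lift)

/-- The Kuratowski pair `⟨a, b⟩ = {{a}, {a, b}}`. -/
def Tm.pair (a b : Tm k) : Tm k := Tm.upair (Tm.single a) (Tm.upair a b)

/-- Zero: `{x | x ≠ x}`. -/
def Tm.zero : Tm k := .abs (Fm.eq (.bound 0) (.bound 0)).neg

/-- The von Neumann successor `{x | x ∈ a ∨ x = a}`. -/
def Tm.succ (a : Tm k) : Tm k :=
  .abs ((Fm.mem (.bound 0) a.lift).or (Fm.eq (.bound 0) a.lift))

/-- The numeral of `n` in the object language. -/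
def Tm.numeral : ℕ → Tm k
  | 0 => Tm.zero
  | n + 1 => Tm.succ (Tm.numeral n)

/-- The natural numbers of the object language:
`{x | ∀ y (0 ∈ y ∧ ∀ z (z ∈ y → z + 1 ∈ y) → x ∈ y)}`. -/
def Tm.nat : Tm k :=
  .abs (.all (((Fm.mem Tm.zero (.bound 0)).and
    (.all ((Fm.mem (.bound 0) (.bound 1)).imp (Fm.mem (Tm.succ (.bound 0)) (.bound 1))))).imp
      (Fm.mem (.bound 1) (.bound 0))))

/-- `a ◁ b`: there are `x, y` in the natural numbers with `⟨x, a⟩` and `⟨y, b⟩` in the enumerator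
and `x < y`; the usual order of von Neumann numbers is membership. -/
def Fm.before (a b : Tm k) : Fm k :=
  .ex (.ex ((((Fm.mem (.bound 1) Tm.nat).and (Fm.mem (.bound 0) Tm.nat)).and
    ((Fm.mem (Tm.pair (.bound 1) a.lift.lift) .enumerator).and
      (Fm.mem (Tm.pair (.bound 0) b.lift.lift) .enumerator))).and
        (Fm.mem (.bound 1) (.bound 0))))

/-- `a ⊴ b`: `a ◁ b` or `a = b`. -/
def Fm.beforeEq (a b : Tm k) : Fm k := (Fm.before a b).or (Fm.eq a b)

end Defined

/-- The librationist capture term `{x | ∃ y (y ∈ a ∧ φ(y, x) ∧ ∀ z (φ(y, z) → x ⊴ z))}`. In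
`φ(s, t)` the variable `0` of `φ` stands for `s` and the variable `1` for `t`. -/
def Tm.capture (a : Tm 0) (φ : Fm 2) : Tm 0 :=
  .abs (.ex (((Fm.mem (.bound 0) a.lift.lift).and (φ.subst ![.bound 0, .bound 1])).and
    (.all ((φ.subst ![.bound 1, .bound 0]).imp (Fm.beforeEq (.bound 2) (.bound 0))))))

/-! ## Expressions as numbers -/

/-- Concatenation of binary numerals, for positive numbers. -/
def cat (m n : ℕ) : ℕ := m * 2 ^ n.size + n

mutual
  /-- The number of a term: the binary numeral of its expression in Polish notation, the `n`-th
  symbol being a one followed by `n` zeros. The symbols `0, …, 5` are the sortifier, the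
  universalizor, the joint of formulas, the alethizor, the enumerator and the juncture of terms;
  noemata and bound variables share the remaining symbols. -/
  def Tm.code : {k : ℕ} → Tm k → ℕ
    | _, .bound i => 2 ^ (2 * i.val + 7)
    | _, .noema n => 2 ^ (2 * n + 6)
    | _, .alethizor => 2 ^ 3
    | _, .enumerator => 2 ^ 4
    | _, .junct a b => cat (2 ^ 5) (cat a.code b.code)
    | _, .abs A => cat (2 ^ 0) A.code
  /-- The number of a formula. -/
  def Fm.code : {k : ℕ} → Fm k → ℕ
    | _, .app b a => cat b.code a.code
    | _, .joint A B => cat (2 ^ 2) (cat A.code B.code)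
    | _, .all A => cat (2 ^ 1) A.code
end

/-- The code `⌜A⌝` of a formula, a numeral of the object language. -/
def Fm.quote (A : Fm 0) : Tm 0 := Tm.numeral A.code

/-! ## Alphabetological variants and the enumeration of cognomina -/

/-- A classical valuation of the formulas: the joint is neither-nor, and a universal formula is true
when all its instances by cognomina are. As there are infinitely many cognomina that do not occur in
given propositions, truth under all of these valuations is classical provability. -/
def ClassicalVal (w : Fm 0 → Prop) : Prop :=
  (∀ A B, w (.joint A B) ↔ ¬ w A ∧ ¬ w B) ∧
    ∀ A : Fm 1, w (.all A) ↔ ∀ a : Tm 0, a.NoNoema → w (A.inst a)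

mutual
  /-- Alphabetological variants among propositions: the classically equivalent ones, and those that
  arise by replacing cognomina by variants. -/
  inductive VarF : Fm 0 → Fm 0 → Prop
    | congruent (A B : Fm 0) : A.NoNoema → B.NoNoema →
        (∀ w, ClassicalVal w → (w A ↔ w B)) → VarF A B
    | replace (C : Fm 1) (a b : Tm 0) : C.NoNoema → VarT a b → VarF (C.inst a) (C.inst b)
    | trans (A B C : Fm 0) : VarF A B → VarF B C → VarF A C
  /-- Alphabetological variants among cognomina. -/
  inductive VarT : Tm 0 → Tm 0 → Prop
    | alethizor : VarT .alethizor .alethizor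
    | enumerator : VarT .enumerator .enumerator
    | junct (a b c d : Tm 0) : VarT a c → VarT b d → VarT (.junct a b) (.junct c d)
    | swap (a b c d : Tm 0) : VarT a d → VarT b c → VarT (.junct a b) (.junct c d)
    | abs (A B : Fm 1) : A.NoNoema → B.NoNoema →
        (∀ d : Tm 0, d.NoNoema → VarF (A.inst d) (B.inst d)) → VarT (.abs A) (.abs B)
end

/-- The enumeration of the cognomina up to variants: `enum n` is a cognomen with the smallest number
among those that are not variants of an earlier one. -/
noncomputable def enum (n : ℕ) : Tm 0 :=
  open Classical in
  if h : {c : Tm 0 | c.NoNoema ∧ ∀ m, (_ : m < n) → ¬ VarT (enum m) c}.Nonempty then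
    Function.argminOn Tm.code _ h
  else .alethizor
termination_by n

/-! ## The semantic process

`E` is the set of the propositions that hold at all stages from some stage on, below the stage under
consideration. -/

/-- Identity of cognomina at a stage: membership in the same terms `{u | B}`. As the other terms
are built from these by junctures, or have memberships that are defined through identity, this is
identity in the sense of `Fm.eq`, that is, membership in the same terms. -/
def Ident (E : Fm 0 → Prop) (a b : Tm 0) : Prop :=
  ∀ B : Fm 1, B.NoNoema → (E (B.inst a) ↔ E (B.inst b))

/-- The cognomen named by the noema `vₙ` at a stage: the `n`-th cognomen of the enumeration, if it is
distinct from what is named by all earlier noemata, and else the one named by `vₙ₋₁`. -/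
noncomputable def naming (E : Fm 0 → Prop) : ℕ → Tm 0
  | 0 => enum 0
  | n + 1 =>
    open Classical in
    if ∀ m, (_ : m ≤ n) → ¬ Ident E (naming E m) (enum (n + 1)) then enum (n + 1) else naming E n

/-- `a ∈ b` at a stage, for cognomina `a` and `b`. -/
def MemAt (E : Fm 0 → Prop) (a : Tm 0) : Tm 0 → Prop
  | .bound i => i.elim0
  | .noema _ => False
  | .alethizor => ∃ A : Fm 0, Ident E a A.quote ∧ E (A.designate (naming E))
  | .enumerator => ∃ (n : ℕ) (b : Tm 0), b.NoNoema ∧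
      Ident E a (Tm.pair (Tm.numeral n) b) ∧ Ident E b (naming E n)
  | .junct b c => ¬ MemAt E a b ∧ ¬ MemAt E a c
  | .abs A => E (A.inst a)

/-- The number of nested logical operations outside terms. -/
def Fm.depth : {k : ℕ} → Fm k → ℕ
  | _, .app _ _ => 0
  | _, .joint A B => A.depth + B.depth + 1
  | _, .all A => A.depth + 1

theorem Fm.depth_subst : ∀ {k m : ℕ} (A : Fm k) (s : Fin k → Tm m), (A.subst s).depth = A.depth
  | _, _, .app _ _, _ => by simp [Fm.subst, Fm.depth]
  | _, _, .joint A B, s => by simp [Fm.subst, Fm.depth, Fm.depth_subst A, Fm.depth_subst B]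
  | _, _, .all A, s => by simp [Fm.subst, Fm.depth, Fm.depth_subst A]

/-- Truth of propositions at a stage. -/
def SatAt (E : Fm 0 → Prop) : Fm 0 → Prop
  | .app b a => MemAt E a b
  | .joint A B => ¬ SatAt E A ∧ ¬ SatAt E B
  | .all A => ∀ a : Tm 0, a.NoNoema → SatAt E (A.inst a)
termination_by A => A.depth
decreasing_by
  all_goals simp [Fm.depth, Fm.inst, Fm.depth_subst]

/-- Truth of propositions at the stage `α` of the process. -/
def Sat (α : Ordinal.{0}) : Fm 0 → Prop :=
  SatAt (fun A => ∃ β, β < α ∧ ∀ γ, β ≤ γ → (_ : γ < α) → Sat γ A)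
termination_by α

/-- The proposition `A` holds at all stages from some stage on below `α`. -/
def Settled (α : Ordinal.{0}) (A : Fm 0) : Prop :=
  ∃ β, β < α ∧ ∀ γ, β ≤ γ → γ < α → Sat γ A

/-- `α ⊨ A`, for all formulas `A`: every noema stands for the cognomen that it names at `α`. -/
def Holds (α : Ordinal.{0}) (A : Fm 0) : Prop := Sat α (A.designate (naming (Settled α)))

/-! ## The closure ordinal and the maxims -/

/-- The formulas `A` such that `𝕋 A` holds at `α`. -/
def TrueAt (α : Ordinal.{0}) : Set (Fm 0) := {A | Holds α A.tr}

/-- The formulas that are stably in. -/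
def IN : Set (Fm 0) := {A | ∃ β, ∀ γ, β ≤ γ → A ∈ TrueAt γ}

/-- The formulas that are stably out. -/
def OUT : Set (Fm 0) := {A | ∃ β, ∀ γ, β ≤ γ → A ∉ TrueAt γ}

/-- The unstable formulas. -/
def UNSTAB : Set (Fm 0) := (IN ∪ OUT)ᶜ

/-- The limit ordinal `κ` covers the process. -/
def Covers (κ : Ordinal.{0}) : Prop :=
  Order.IsSuccLimit κ ∧ ∀ γ, κ ≤ γ → IN ⊆ TrueAt γ ∧ TrueAt γ ⊆ IN ∪ UNSTAB

/-- The limit ordinal `σ` stabilizes the process. -/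
def Stabilizes (σ : Ordinal.{0}) : Prop := Covers σ ∧ TrueAt σ ⊆ IN

/-- The closure ordinal: the least ordinal that stabilizes the process. -/
noncomputable def koppa : Ordinal.{0} := sInf {σ | Stabilizes σ}

/-- `A` is a maxim of the theory: `𝕋 A` holds at the closure ordinal. -/
def Maxim (A : Fm 0) : Prop := Holds koppa A.tr

/-! ## Choice -/

/-- Every member of `c` is a nonempty kind. -/
def Fm.nonemptyKinds (c : Tm 0) : Fm 0 :=
  .all ((Fm.mem (.bound 0) c.lift).imp
    ((Fm.kind (.bound 0)).and (.ex (Fm.mem (.bound 0) (.bound 1)))))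

/-- Any two members of `c` that are not coextensional have an empty intersection. -/
def Fm.disjointMembers (c : Tm 0) : Fm 0 :=
  .all (.all ((((Fm.mem (.bound 1) c.lift.lift).and (Fm.mem (.bound 0) c.lift.lift)).and
    (Fm.coext (.bound 1) (.bound 0)).neg).imp
      (Fm.ex ((Fm.mem (.bound 0) (.bound 2)).and (Fm.mem (.bound 0) (.bound 1)))).neg))

/-- `w` has precisely one element from each member of `c`:
`∀ y (y ∈ c → ∃ x (x ∈ w ∧ x ∈ y ∧ ∀ z (z ∈ w ∧ z ∈ y → z = x ∧ z coextensional with x)))`. -/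
def Fm.selects {k : ℕ} (w c : Tm k) : Fm k :=
  .all ((Fm.mem (.bound 0) c.lift).imp
    (.ex (((Fm.mem (.bound 0) w.lift.lift).and (Fm.mem (.bound 0) (.bound 1))).and
      (.all (((Fm.mem (.bound 0) w.lift.lift.lift).and (Fm.mem (.bound 0) (.bound 2))).imp
        ((Fm.eq (.bound 0) (.bound 1)).and (Fm.coext (.bound 0) (.bound 1))))))))

/-- The capture term `{x | ∃ y (y ∈ c ∧ x ∈ y ∧ ∀ z (z ∈ y → x ⊴ z))}`. -/
def Tm.choice (c : Tm 0) : Tm 0 := Tm.capture c (Fm.mem (.bound 1) (.bound 0))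

end Libra

/-!
From the closure ordinal `κ` on, everything that the choice term refers to is constant, so that the
proposition reduces to choosing, from each member of `c`, the element with the earliest name.

Identity is controlled at all stages. At a stage `α` it is the agreement of all `B(a)` and `B(b)` on
being settled, and as `B` may itself speak of what was settled before, identity at a stage implies
identity at all earlier ones (`Ident.of_le`). Two consequences follow. First, identity is eventually
constant, and so is the naming of cognomina by noemata, which depends on identity alone; a stage past
which the stably true and the stably false propositions have taken their final values, and below which
all other propositions fail cofinally often, is then stabilizing (`exists_stabilizes`). Secondly, a
formula `a = b` settled at `κ` holds ever after, so identity, naming and the truth of substitution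
instances under identity are fixed from `κ` on (`ident_iff_same`, `naming_eq_name`, `sat_congr`). The
maxims are thus the formulas that hold at every stage `γ ≥ κ` when each noema is replaced by the
cognomen that it names at `κ` (`maxim_iff`).

Every cognomen has a name. Variants are identical at every stage (`VarT.ident`), by induction on the
stage and on the derivation of the variance; and the enumeration meets every class of variants,
because only finitely many expressions have numbers below a given bound (`exists_varT_enum`).

If the instance of `A` at `x` has a constant truth value from `κ` on, then so has `x ∈ {u | A}`. In
this way pairs, numerals and the enumerator get their intended meaning at all `γ ≥ κ`, and `x ◁ z`
comes to say that a name of `x` has a smaller index than some name of `z` (`sat_before`). As the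
indices of the names of one cognomen form an interval, `⊴` is antisymmetric up to identity
(`NamedUpTo.antisymm`), and a nonempty kind has a member with the least name (`exists_namedUpTo`).
Membership in the choice term is therefore constant, which makes it a kind (`sat_mem_choice`), and two
of its elements in the same member of `c` are least in coextensional kinds, hence identical
(`sat_selects_choice`).
-/

namespace Libra

/-! ### Renaming, substitution and designation -/

theorem upr_comp {k m l : ℕ} (f : Fin k → Fin m) (g : Fin m → Fin l) :
    upr g ∘ upr f = upr (g ∘ f) := by
  funext i
  refine Fin.cases ?_ (fun j => ?_) i <;> simp [upr]

mutual
  theorem Tm.rename_rename : ∀ {k m l : ℕ} (a : Tm k) (f : Fin k → Fin m) (g : Fin m → Fin l),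
      (a.rename f).rename g = a.rename (g ∘ f)
    | _, _, _, .bound _, _, _ => by simp [Tm.rename]
    | _, _, _, .noema _, _, _ => by simp [Tm.rename]
    | _, _, _, .alethizor, _, _ => by simp [Tm.rename]
    | _, _, _, .enumerator, _, _ => by simp [Tm.rename]
    | _, _, _, .junct a b, f, g => by
      simp [Tm.rename, Tm.rename_rename a, Tm.rename_rename b]
    | _, _, _, .abs A, f, g => by simp [Tm.rename, Fm.rename_rename A, upr_comp]
  theorem Fm.rename_rename : ∀ {k m l : ℕ} (A : Fm k) (f : Fin k → Fin m) (g : Fin m → Fin l),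
      (A.rename f).rename g = A.rename (g ∘ f)
    | _, _, _, .app b a, f, g => by simp [Fm.rename, Tm.rename_rename a, Tm.rename_rename b]
    | _, _, _, .joint A B, f, g => by simp [Fm.rename, Fm.rename_rename A, Fm.rename_rename B]
    | _, _, _, .all A, f, g => by simp [Fm.rename, Fm.rename_rename A, upr_comp]
end

theorem ups_comp_upr {k m l : ℕ} (f : Fin k → Fin m) (s : Fin m → Tm l) :
    ups s ∘ upr f = ups (s ∘ f) := by
  funext i
  refine Fin.cases ?_ (fun j => ?_) i <;> simp [upr, ups]

mutual
  theorem Tm.rename_subst : ∀ {k m l : ℕ} (a : Tm k) (f : Fin k → Fin m) (s : Fin m → Tm l),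
      (a.rename f).subst s = a.subst (s ∘ f)
    | _, _, _, .bound _, _, _ => by simp [Tm.rename, Tm.subst]
    | _, _, _, .noema _, _, _ => by simp [Tm.rename, Tm.subst]
    | _, _, _, .alethizor, _, _ => by simp [Tm.rename, Tm.subst]
    | _, _, _, .enumerator, _, _ => by simp [Tm.rename, Tm.subst]
    | _, _, _, .junct a b, f, g => by
      simp [Tm.rename, Tm.subst, Tm.rename_subst a, Tm.rename_subst b]
    | _, _, _, .abs A, f, g => by simp [Tm.rename, Tm.subst, Fm.rename_subst A, ups_comp_upr]
  theorem Fm.rename_subst : ∀ {k m l : ℕ} (A : Fm k) (f : Fin k → Fin m) (s : Fin m → Tm l),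
      (A.rename f).subst s = A.subst (s ∘ f)
    | _, _, _, .app b a, f, g => by
      simp [Fm.rename, Fm.subst, Tm.rename_subst a, Tm.rename_subst b]
    | _, _, _, .joint A B, f, g => by
      simp [Fm.rename, Fm.subst, Fm.rename_subst A, Fm.rename_subst B]
    | _, _, _, .all A, f, g => by simp [Fm.rename, Fm.subst, Fm.rename_subst A, ups_comp_upr]
end

theorem ups_rename {k m l : ℕ} (s : Fin k → Tm m) (f : Fin m → Fin l) :
    (fun i => (ups s i).rename (upr f)) = ups (fun i => (s i).rename f) := by
  funext i
  refine Fin.cases ?_ (fun j => ?_) i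
  · simp [ups, upr, Tm.rename]
  · simp only [ups, Fin.cons_succ, Tm.lift, Tm.rename_rename]
    congr 1

mutual
  theorem Tm.subst_rename : ∀ {k m l : ℕ} (a : Tm k) (s : Fin k → Tm m) (f : Fin m → Fin l),
      (a.subst s).rename f = a.subst (fun i => (s i).rename f)
    | _, _, _, .bound _, _, _ => by simp [Tm.subst]
    | _, _, _, .noema _, _, _ => by simp [Tm.rename, Tm.subst]
    | _, _, _, .alethizor, _, _ => by simp [Tm.rename, Tm.subst]
    | _, _, _, .enumerator, _, _ => by simp [Tm.rename, Tm.subst]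
    | _, _, _, .junct a b, f, g => by
      simp [Tm.rename, Tm.subst, Tm.subst_rename a, Tm.subst_rename b]
    | _, _, _, .abs A, f, g => by simp [Tm.rename, Tm.subst, Fm.subst_rename A, ups_rename]
  theorem Fm.subst_rename : ∀ {k m l : ℕ} (A : Fm k) (s : Fin k → Tm m) (f : Fin m → Fin l),
      (A.subst s).rename f = A.subst (fun i => (s i).rename f)
    | _, _, _, .app b a, f, g => by
      simp [Fm.rename, Fm.subst, Tm.subst_rename a, Tm.subst_rename b]
    | _, _, _, .joint A B, f, g => by
      simp [Fm.rename, Fm.subst, Fm.subst_rename A, Fm.subst_rename B]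
    | _, _, _, .all A, f, g => by simp [Fm.rename, Fm.subst, Fm.subst_rename A, ups_rename]
end

theorem Tm.lift_subst_ups {k m : ℕ} (a : Tm k) (s : Fin k → Tm m) :
    a.lift.subst (ups s) = (a.subst s).lift := by
  rw [Tm.lift, Tm.lift, Tm.rename_subst, Tm.subst_rename]
  congr 1

theorem Fm.lift_subst_ups {k m : ℕ} (A : Fm k) (s : Fin k → Tm m) :
    A.lift.subst (ups s) = (A.subst s).lift := by
  rw [Fm.lift, Fm.lift, Fm.rename_subst, Fm.subst_rename]
  congr 1

theorem ups_subst {k m l : ℕ} (s : Fin k → Tm m) (t : Fin m → Tm l) :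
    (fun i => (ups s i).subst (ups t)) = ups (fun i => (s i).subst t) := by
  funext i
  refine Fin.cases ?_ (fun j => ?_) i
  · simp [ups, Tm.subst]
  · have := Tm.lift_subst_ups (s j) t
    simpa [ups] using this

mutual
  theorem Tm.subst_subst : ∀ {k m l : ℕ} (a : Tm k) (s : Fin k → Tm m) (t : Fin m → Tm l),
      (a.subst s).subst t = a.subst (fun i => (s i).subst t)
    | _, _, _, .bound _, _, _ => by simp [Tm.subst]
    | _, _, _, .noema _, _, _ => by simp [Tm.subst]
    | _, _, _, .alethizor, _, _ => by simp [Tm.subst]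
    | _, _, _, .enumerator, _, _ => by simp [Tm.subst]
    | _, _, _, .junct a b, f, g => by simp [Tm.subst, Tm.subst_subst a, Tm.subst_subst b]
    | _, _, _, .abs A, f, g => by simp [Tm.subst, Fm.subst_subst A, ups_subst]
  theorem Fm.subst_subst : ∀ {k m l : ℕ} (A : Fm k) (s : Fin k → Tm m) (t : Fin m → Tm l),
      (A.subst s).subst t = A.subst (fun i => (s i).subst t)
    | _, _, _, .app b a, f, g => by simp [Fm.subst, Tm.subst_subst a, Tm.subst_subst b]
    | _, _, _, .joint A B, f, g => by simp [Fm.subst, Fm.subst_subst A, Fm.subst_subst B]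
    | _, _, _, .all A, f, g => by simp [Fm.subst, Fm.subst_subst A, ups_subst]
end

theorem ups_bound {k : ℕ} : ups (fun i : Fin k => Tm.bound i) = fun i => .bound i := by
  funext i
  refine Fin.cases ?_ (fun j => ?_) i <;> simp [ups, Tm.lift, Tm.rename]

mutual
  theorem Tm.subst_bound : ∀ {k : ℕ} (a : Tm k), a.subst (fun i => .bound i) = a
    | _, .bound _ => by simp [Tm.subst]
    | _, .noema _ => by simp [Tm.subst]
    | _, .alethizor => by simp [Tm.subst]
    | _, .enumerator => by simp [Tm.subst]
    | _, .junct a b => by simp [Tm.subst, Tm.subst_bound a, Tm.subst_bound b]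
    | _, .abs A => by simp [Tm.subst, ups_bound, Fm.subst_bound A]
  theorem Fm.subst_bound : ∀ {k : ℕ} (A : Fm k), A.subst (fun i => .bound i) = A
    | _, .app b a => by simp [Fm.subst, Tm.subst_bound a, Tm.subst_bound b]
    | _, .joint A B => by simp [Fm.subst, Fm.subst_bound A, Fm.subst_bound B]
    | _, .all A => by simp [Fm.subst, ups_bound, Fm.subst_bound A]
end

@[simp] theorem Tm.subst_closed (a : Tm 0) (s : Fin 0 → Tm 0) : a.subst s = a := by
  rw [Subsingleton.elim s (fun i => .bound i), Tm.subst_bound]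

@[simp] theorem Fm.subst_closed (A : Fm 0) (s : Fin 0 → Tm 0) : A.subst s = A := by
  rw [Subsingleton.elim s (fun i => .bound i), Fm.subst_bound]

@[simp] theorem Tm.rename_closed (a : Tm 0) (f : Fin 0 → Fin 0) : a.rename f = a := by
  have h := Tm.subst_rename a (fun i => .bound i) f
  rwa [Tm.subst_bound, Tm.subst_closed] at h

@[simp] theorem Tm.lift_subst_cons {k m : ℕ} (a : Tm k) (x : Tm m) (s : Fin k → Tm m) :
    a.lift.subst (Fin.cons x s : Fin (k + 1) → Tm m) = a.subst s := by
  rw [Tm.lift, Tm.rename_subst]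
  congr 1

@[simp] theorem Fm.lift_subst_cons {k m : ℕ} (A : Fm k) (x : Tm m) (s : Fin k → Tm m) :
    A.lift.subst (Fin.cons x s : Fin (k + 1) → Tm m) = A.subst s := by
  rw [Fm.lift, Fm.rename_subst]
  congr 1

@[simp] theorem Tm.lift_subst_const {m : ℕ} (a : Tm 0) (s : Fin 1 → Tm m) :
    a.lift.subst s = a.rename Fin.elim0 := by
  have h := Tm.subst_rename a (fun i => .bound i) (Fin.elim0 : Fin 0 → Fin m)
  rw [Tm.subst_bound] at h
  rw [Tm.lift, Tm.rename_subst, h]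
  congr 1
  exact Subsingleton.elim _ _

theorem Fm.inst_eq (A : Fm 1) (a : Tm 0) :
    A.inst a = A.subst (Fin.cons a (fun i => .bound i)) := by
  rw [Fm.inst]
  congr 1
  funext i
  rw [Subsingleton.elim i 0, Fin.cons_zero]

/-- Instantiating the outermost variable after a substitution under a binder is one substitution, which
extends the given one by the instance. -/
theorem Fm.subst_ups_inst {k : ℕ} (A : Fm (k + 1)) (s : Fin k → Tm 0) (a : Tm 0) :
    (A.subst (ups s)).inst a = A.subst (Fin.cons a s) := by
  rw [Fm.inst_eq, Fm.subst_subst]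
  congr 1
  funext i
  refine Fin.cases ?_ (fun j => ?_) i
  · simp [ups, Tm.subst]
  · simp only [ups, Fin.cons_succ]
    simp

/-! ### Designation -/

mutual
  theorem Tm.designate_rename (r : ℕ → Tm 0) : ∀ {k m : ℕ} (a : Tm k) (f : Fin k → Fin m),
      (a.rename f).designate r = (a.designate r).rename f
    | _, _, .bound _, _ => by simp [Tm.rename, Tm.designate]
    | _, _, .noema _, f => by
      simp only [Tm.rename, Tm.designate, Tm.rename_rename]
      congr 1
      exact Subsingleton.elim _ _
    | _, _, .alethizor, _ => by simp [Tm.rename, Tm.designate]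
    | _, _, .enumerator, _ => by simp [Tm.rename, Tm.designate]
    | _, _, .junct a b, f => by
      simp [Tm.rename, Tm.designate, Tm.designate_rename r a, Tm.designate_rename r b]
    | _, _, .abs A, f => by simp [Tm.rename, Tm.designate, Fm.designate_rename r A]
  theorem Fm.designate_rename (r : ℕ → Tm 0) : ∀ {k m : ℕ} (A : Fm k) (f : Fin k → Fin m),
      (A.rename f).designate r = (A.designate r).rename f
    | _, _, .app b a, f => by
      simp [Fm.rename, Fm.designate, Tm.designate_rename r a, Tm.designate_rename r b]
    | _, _, .joint A B, f => by
      simp [Fm.rename, Fm.designate, Fm.designate_rename r A, Fm.designate_rename r B]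
    | _, _, .all A, f => by simp [Fm.rename, Fm.designate, Fm.designate_rename r A]
end

@[simp] theorem Tm.designate_lift (r : ℕ → Tm 0) {k : ℕ} (a : Tm k) :
    a.lift.designate r = (a.designate r).lift := Tm.designate_rename r a _

@[simp] theorem Fm.designate_lift (r : ℕ → Tm 0) {k : ℕ} (A : Fm k) :
    A.lift.designate r = (A.designate r).lift := Fm.designate_rename r A _

mutual
  theorem Tm.NoNoema.designate_eq (r : ℕ → Tm 0) : ∀ {k : ℕ} {a : Tm k}, a.NoNoema →
      a.designate r = a
    | _, .bound _, _ => by simp [Tm.designate]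
    | _, .noema _, h => by simp [Tm.NoNoema] at h
    | _, .alethizor, _ => by simp [Tm.designate]
    | _, .enumerator, _ => by simp [Tm.designate]
    | _, .junct a b, h => by
      simp only [Tm.NoNoema] at h
      simp [Tm.designate, Tm.NoNoema.designate_eq r h.1, Tm.NoNoema.designate_eq r h.2]
    | _, .abs A, h => by
      simp only [Tm.NoNoema] at h
      simp [Tm.designate, Fm.NoNoema.designate_eq r h]
  theorem Fm.NoNoema.designate_eq (r : ℕ → Tm 0) : ∀ {k : ℕ} {A : Fm k}, A.NoNoema →
      A.designate r = A
    | _, .app b a, h => by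
      simp only [Fm.NoNoema] at h
      simp [Fm.designate, Tm.NoNoema.designate_eq r h.1, Tm.NoNoema.designate_eq r h.2]
    | _, .joint A B, h => by
      simp only [Fm.NoNoema] at h
      simp [Fm.designate, Fm.NoNoema.designate_eq r h.1, Fm.NoNoema.designate_eq r h.2]
    | _, .all A, h => by
      simp only [Fm.NoNoema] at h
      simp [Fm.designate, Fm.NoNoema.designate_eq r h]
end

mutual
  theorem Tm.NoNoema.rename : ∀ {k m : ℕ} {a : Tm k}, a.NoNoema → ∀ f : Fin k → Fin m,
      (a.rename f).NoNoema
    | _, _, .bound _, _, _ => by simp [Tm.rename, Tm.NoNoema]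
    | _, _, .noema _, h, _ => by simp [Tm.NoNoema] at h
    | _, _, .alethizor, _, _ => by simp [Tm.rename, Tm.NoNoema]
    | _, _, .enumerator, _, _ => by simp [Tm.rename, Tm.NoNoema]
    | _, _, .junct a b, h, f => by
      simp only [Tm.NoNoema] at h
      simp [Tm.rename, Tm.NoNoema, Tm.NoNoema.rename h.1, Tm.NoNoema.rename h.2]
    | _, _, .abs A, h, f => by
      simp only [Tm.NoNoema] at h
      simp [Tm.rename, Tm.NoNoema, Fm.NoNoema.rename h]
  theorem Fm.NoNoema.rename : ∀ {k m : ℕ} {A : Fm k}, A.NoNoema → ∀ f : Fin k → Fin m,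
      (A.rename f).NoNoema
    | _, _, .app b a, h, f => by
      simp only [Fm.NoNoema] at h
      simp [Fm.rename, Fm.NoNoema, Tm.NoNoema.rename h.1, Tm.NoNoema.rename h.2]
    | _, _, .joint A B, h, f => by
      simp only [Fm.NoNoema] at h
      simp [Fm.rename, Fm.NoNoema, Fm.NoNoema.rename h.1, Fm.NoNoema.rename h.2]
    | _, _, .all A, h, f => by
      simp only [Fm.NoNoema] at h
      simp [Fm.rename, Fm.NoNoema, Fm.NoNoema.rename h]
end

theorem Tm.NoNoema.lift {k : ℕ} {a : Tm k} (h : a.NoNoema) : a.lift.NoNoema := h.rename _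

theorem Fm.NoNoema.lift {k : ℕ} {A : Fm k} (h : A.NoNoema) : A.lift.NoNoema := h.rename _

theorem NoNoema.ups {k m : ℕ} {s : Fin k → Tm m} (h : ∀ i, (s i).NoNoema) (i : Fin (k + 1)) :
    (Libra.ups s i).NoNoema := by
  refine Fin.cases ?_ (fun j => ?_) i
  · simp [Libra.ups, Tm.NoNoema]
  · simpa [Libra.ups] using (h j).lift

mutual
  theorem Tm.NoNoema.subst : ∀ {k m : ℕ} {a : Tm k}, a.NoNoema → ∀ {s : Fin k → Tm m},
      (∀ i, (s i).NoNoema) → (a.subst s).NoNoema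
    | _, _, .bound _, _, _, hs => by simp [Tm.subst, hs]
    | _, _, .noema _, h, _, _ => by simp [Tm.NoNoema] at h
    | _, _, .alethizor, _, _, _ => by simp [Tm.subst, Tm.NoNoema]
    | _, _, .enumerator, _, _, _ => by simp [Tm.subst, Tm.NoNoema]
    | _, _, .junct a b, h, _, hs => by
      simp only [Tm.NoNoema] at h
      simp [Tm.subst, Tm.NoNoema, Tm.NoNoema.subst h.1 hs, Tm.NoNoema.subst h.2 hs]
    | _, _, .abs A, h, _, hs => by
      simp only [Tm.NoNoema] at h
      simp [Tm.subst, Tm.NoNoema, Fm.NoNoema.subst h (NoNoema.ups hs)]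
  theorem Fm.NoNoema.subst : ∀ {k m : ℕ} {A : Fm k}, A.NoNoema → ∀ {s : Fin k → Tm m},
      (∀ i, (s i).NoNoema) → (A.subst s).NoNoema
    | _, _, .app b a, h, _, hs => by
      simp only [Fm.NoNoema] at h
      simp [Fm.subst, Fm.NoNoema, Tm.NoNoema.subst h.1 hs, Tm.NoNoema.subst h.2 hs]
    | _, _, .joint A B, h, _, hs => by
      simp only [Fm.NoNoema] at h
      simp [Fm.subst, Fm.NoNoema, Fm.NoNoema.subst h.1 hs, Fm.NoNoema.subst h.2 hs]
    | _, _, .all A, h, _, hs => by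
      simp only [Fm.NoNoema] at h
      simp [Fm.subst, Fm.NoNoema, Fm.NoNoema.subst h (NoNoema.ups hs)]
end

theorem Fm.NoNoema.inst {A : Fm 1} (h : A.NoNoema) {a : Tm 0} (ha : a.NoNoema) :
    (A.inst a).NoNoema := h.subst fun _ => ha

mutual
  theorem Tm.noNoema_designate {r : ℕ → Tm 0} (hr : ∀ n, (r n).NoNoema) :
      ∀ {k : ℕ} (a : Tm k), (a.designate r).NoNoema
    | _, .bound _ => by simp [Tm.designate, Tm.NoNoema]
    | _, .noema n => by simpa [Tm.designate] using (hr n).rename _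
    | _, .alethizor => by simp [Tm.designate, Tm.NoNoema]
    | _, .enumerator => by simp [Tm.designate, Tm.NoNoema]
    | _, .junct a b => by
      simp [Tm.designate, Tm.NoNoema, Tm.noNoema_designate hr a, Tm.noNoema_designate hr b]
    | _, .abs A => by simp [Tm.designate, Tm.NoNoema, Fm.noNoema_designate hr A]
  theorem Fm.noNoema_designate {r : ℕ → Tm 0} (hr : ∀ n, (r n).NoNoema) :
      ∀ {k : ℕ} (A : Fm k), (A.designate r).NoNoema
    | _, .app b a => by
      simp [Fm.designate, Fm.NoNoema, Tm.noNoema_designate hr a, Tm.noNoema_designate hr b]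
    | _, .joint A B => by
      simp [Fm.designate, Fm.NoNoema, Fm.noNoema_designate hr A, Fm.noNoema_designate hr B]
    | _, .all A => by simp [Fm.designate, Fm.NoNoema, Fm.noNoema_designate hr A]
end

/-! ### Substitution and designation in the defined notions -/

section
variable {k m : ℕ} (s : Fin k → Tm m)

@[simp] theorem Fm.subst_mem (a b : Tm k) :
    (Fm.mem a b).subst s = Fm.mem (a.subst s) (b.subst s) := by simp [Fm.mem, Fm.subst]

@[simp] theorem Fm.subst_neg (A : Fm k) : A.neg.subst s = (A.subst s).neg := by
  simp [Fm.neg, Fm.subst]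

@[simp] theorem Fm.subst_or (A B : Fm k) : (A.or B).subst s = (A.subst s).or (B.subst s) := by
  simp [Fm.or, Fm.subst]

@[simp] theorem Fm.subst_and (A B : Fm k) : (A.and B).subst s = (A.subst s).and (B.subst s) := by
  simp [Fm.and, Fm.subst]

@[simp] theorem Fm.subst_imp (A B : Fm k) : (A.imp B).subst s = (A.subst s).imp (B.subst s) := by
  simp [Fm.imp, Fm.subst]

@[simp] theorem Fm.subst_iff (A B : Fm k) : (A.iff B).subst s = (A.subst s).iff (B.subst s) := by
  simp [Fm.iff]

@[simp] theorem Fm.subst_all (A : Fm (k + 1)) :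
    (Fm.all A).subst s = Fm.all (A.subst (ups s)) := by simp [Fm.subst]

@[simp] theorem Fm.subst_ex (A : Fm (k + 1)) : A.ex.subst s = (A.subst (ups s)).ex := by
  simp [Fm.ex]

@[simp] theorem Tm.subst_abs (A : Fm (k + 1)) :
    (Tm.abs A).subst s = Tm.abs (A.subst (ups s)) := by simp [Tm.subst]

@[simp] theorem Tm.subst_bound_apply (i : Fin k) : (Tm.bound i).subst s = s i := by
  simp [Tm.subst]

@[simp] theorem Tm.subst_enumerator : (Tm.enumerator : Tm k).subst s = .enumerator := by
  simp [Tm.subst]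

@[simp] theorem ups_zero : ups s 0 = .bound 0 := rfl

@[simp] theorem ups_succ (i : Fin k) : ups s i.succ = (s i).lift := rfl

@[simp] theorem Fm.subst_tr (A : Fm k) : A.tr.subst s = (A.subst s).tr := by
  simp [Fm.tr, Fm.lift_subst_ups]

@[simp] theorem Fm.subst_eq (a b : Tm k) :
    (Fm.eq a b).subst s = Fm.eq (a.subst s) (b.subst s) := by
  simp [Fm.eq, Tm.lift_subst_ups]

@[simp] theorem Fm.subst_coext (a b : Tm k) :
    (Fm.coext a b).subst s = Fm.coext (a.subst s) (b.subst s) := by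
  simp [Fm.coext, Tm.lift_subst_ups]

@[simp] theorem Fm.subst_kind (a : Tm k) : (Fm.kind a).subst s = Fm.kind (a.subst s) := by
  simp [Fm.kind, Tm.lift_subst_ups]

@[simp] theorem Tm.subst_upair (a b : Tm k) :
    (Tm.upair a b).subst s = Tm.upair (a.subst s) (b.subst s) := by
  simp [Tm.upair, Tm.lift_subst_ups]

@[simp] theorem Tm.subst_single (a : Tm k) :
    (Tm.single a).subst s = Tm.single (a.subst s) := by
  simp [Tm.single, Tm.lift_subst_ups]

@[simp] theorem Tm.subst_pair (a b : Tm k) :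
    (Tm.pair a b).subst s = Tm.pair (a.subst s) (b.subst s) := by
  simp [Tm.pair]

@[simp] theorem Tm.subst_zero : (Tm.zero : Tm k).subst s = Tm.zero := by
  simp [Tm.zero]

@[simp] theorem Tm.subst_succ (a : Tm k) : (Tm.succ a).subst s = Tm.succ (a.subst s) := by
  simp [Tm.succ, Tm.lift_subst_ups]

@[simp] theorem Tm.subst_nat : (Tm.nat : Tm k).subst s = Tm.nat := by
  have h1 : ups (ups s) 1 = .bound 1 := rfl
  have h2 : ups (ups (ups s)) 1 = .bound 1 := rfl
  simp [Tm.nat, h1, h2]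

@[simp] theorem Fm.subst_before (a b : Tm k) :
    (Fm.before a b).subst s = Fm.before (a.subst s) (b.subst s) := by
  have h1 : ups (ups s) 1 = .bound 1 := rfl
  simp [Fm.before, Tm.lift_subst_ups, h1]

@[simp] theorem Fm.subst_beforeEq (a b : Tm k) :
    (Fm.beforeEq a b).subst s = Fm.beforeEq (a.subst s) (b.subst s) := by
  simp [Fm.beforeEq]

@[simp] theorem Fm.subst_selects (a b : Tm k) :
    (Fm.selects a b).subst s = Fm.selects (a.subst s) (b.subst s) := by
  have h1 : ups (ups s) 1 = .bound 1 := rfl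
  have h2 : ups (ups (ups s)) 1 = .bound 1 := rfl
  have h3 : ups (ups (ups s)) 2 = .bound 2 := rfl
  simp [Fm.selects, Tm.lift_subst_ups, h1, h2, h3]

end

section
variable {k : ℕ} (r : ℕ → Tm 0)

@[simp] theorem Fm.designate_mem (a b : Tm k) :
    (Fm.mem a b).designate r = Fm.mem (a.designate r) (b.designate r) := by
  simp [Fm.mem, Fm.designate]

@[simp] theorem Fm.designate_neg (A : Fm k) : A.neg.designate r = (A.designate r).neg := by
  simp [Fm.neg, Fm.designate]

@[simp] theorem Fm.designate_or (A B : Fm k) :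
    (A.or B).designate r = (A.designate r).or (B.designate r) := by
  simp [Fm.or, Fm.designate]

@[simp] theorem Fm.designate_and (A B : Fm k) :
    (A.and B).designate r = (A.designate r).and (B.designate r) := by
  simp [Fm.and, Fm.designate]

@[simp] theorem Fm.designate_imp (A B : Fm k) :
    (A.imp B).designate r = (A.designate r).imp (B.designate r) := by
  simp [Fm.imp, Fm.designate]

@[simp] theorem Fm.designate_iff (A B : Fm k) :
    (A.iff B).designate r = (A.designate r).iff (B.designate r) := by
  simp [Fm.iff]

@[simp] theorem Fm.designate_all (A : Fm (k + 1)) :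
    (Fm.all A).designate r = Fm.all (A.designate r) := by simp [Fm.designate]

@[simp] theorem Fm.designate_ex (A : Fm (k + 1)) : A.ex.designate r = (A.designate r).ex := by
  simp [Fm.ex]

@[simp] theorem Tm.designate_abs (A : Fm (k + 1)) :
    (Tm.abs A).designate r = Tm.abs (A.designate r) := by simp [Tm.designate]

@[simp] theorem Tm.designate_bound (i : Fin k) : (Tm.bound i).designate r = .bound i := by
  simp [Tm.designate]

@[simp] theorem Tm.designate_enumerator :
    (Tm.enumerator : Tm k).designate r = .enumerator := by
  simp [Tm.designate]

@[simp] theorem Fm.designate_tr (A : Fm k) : A.tr.designate r = (A.designate r).tr := by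
  simp [Fm.tr]

@[simp] theorem Fm.designate_eq (a b : Tm k) :
    (Fm.eq a b).designate r = Fm.eq (a.designate r) (b.designate r) := by
  simp [Fm.eq]

@[simp] theorem Fm.designate_coext (a b : Tm k) :
    (Fm.coext a b).designate r = Fm.coext (a.designate r) (b.designate r) := by
  simp [Fm.coext]

@[simp] theorem Fm.designate_kind (a : Tm k) :
    (Fm.kind a).designate r = Fm.kind (a.designate r) := by
  simp [Fm.kind]

@[simp] theorem Tm.designate_pair (a b : Tm k) :
    (Tm.pair a b).designate r = Tm.pair (a.designate r) (b.designate r) := by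
  simp [Tm.pair, Tm.upair, Tm.single]

@[simp] theorem Tm.designate_nat : (Tm.nat : Tm k).designate r = Tm.nat := by
  simp [Tm.nat, Tm.zero, Tm.succ]

@[simp] theorem Fm.designate_beforeEq (a b : Tm k) :
    (Fm.beforeEq a b).designate r = Fm.beforeEq (a.designate r) (b.designate r) := by
  simp [Fm.beforeEq, Fm.before]

@[simp] theorem Fm.designate_selects (a b : Tm k) :
    (Fm.selects a b).designate r = Fm.selects (a.designate r) (b.designate r) := by
  simp [Fm.selects]

theorem Tm.choice_eq (c : Tm 0) :
    Tm.choice c = .abs (.ex (((Fm.mem (.bound 0) c.lift.lift).and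
      (Fm.mem (.bound 1) (.bound 0))).and (.all ((Fm.mem (.bound 0) (.bound 1)).imp
        (Fm.beforeEq (.bound 2) (.bound 0)))))) := by
  simp [Tm.choice, Tm.capture]

@[simp] theorem Tm.designate_choice (c : Tm 0) :
    (Tm.choice c).designate r = Tm.choice (c.designate r) := by
  simp [Tm.choice_eq]

@[simp] theorem Fm.designate_nonemptyKinds (c : Tm 0) :
    (Fm.nonemptyKinds c).designate r = Fm.nonemptyKinds (c.designate r) := by
  simp [Fm.nonemptyKinds]

@[simp] theorem Fm.designate_disjointMembers (c : Tm 0) :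
    (Fm.disjointMembers c).designate r = Fm.disjointMembers (c.designate r) := by
  simp [Fm.disjointMembers]

end

/-! ### Truth at a stage -/

theorem satAt_mem (E : Fm 0 → Prop) (a b : Tm 0) : SatAt E (Fm.mem a b) ↔ MemAt E a b := by
  rw [Fm.mem, SatAt]

theorem satAt_joint (E : Fm 0 → Prop) (A B : Fm 0) :
    SatAt E (.joint A B) ↔ ¬ SatAt E A ∧ ¬ SatAt E B := by
  rw [SatAt]

theorem satAt_all (E : Fm 0 → Prop) (A : Fm 1) :
    SatAt E (.all A) ↔ ∀ a : Tm 0, a.NoNoema → SatAt E (A.inst a) := by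
  rw [SatAt]

theorem classicalVal_satAt (E : Fm 0 → Prop) : ClassicalVal (SatAt E) :=
  ⟨satAt_joint E, satAt_all E⟩

/-- The recursion clause of the process. -/
theorem sat_iff_satAt (α : Ordinal.{0}) (A : Fm 0) : Sat α A ↔ SatAt (Settled α) A := by
  rw [Sat]
  rfl

section
variable {α : Ordinal.{0}}

theorem sat_mem (a b : Tm 0) : Sat α (Fm.mem a b) ↔ MemAt (Settled α) a b := by
  rw [sat_iff_satAt, satAt_mem]

theorem sat_joint (A B : Fm 0) : Sat α (.joint A B) ↔ ¬ Sat α A ∧ ¬ Sat α B := by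
  simp only [sat_iff_satAt, satAt_joint]

@[simp] theorem sat_all (A : Fm 1) :
    Sat α (.all A) ↔ ∀ a : Tm 0, a.NoNoema → Sat α (A.inst a) := by
  simp only [sat_iff_satAt, satAt_all]

@[simp] theorem sat_neg (A : Fm 0) : Sat α A.neg ↔ ¬ Sat α A := by
  simp [Fm.neg, sat_joint]

@[simp] theorem sat_or (A B : Fm 0) : Sat α (A.or B) ↔ Sat α A ∨ Sat α B := by
  simp only [Fm.or, sat_joint]; tauto

@[simp] theorem sat_and (A B : Fm 0) : Sat α (A.and B) ↔ Sat α A ∧ Sat α B := by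
  simp only [Fm.and, sat_joint]; tauto

@[simp] theorem sat_imp (A B : Fm 0) : Sat α (A.imp B) ↔ (Sat α A → Sat α B) := by
  simp only [Fm.imp, sat_joint]; tauto

@[simp] theorem sat_iff (A B : Fm 0) : Sat α (A.iff B) ↔ (Sat α A ↔ Sat α B) := by
  simp only [Fm.iff, sat_and, sat_imp]; tauto

@[simp] theorem sat_ex (A : Fm 1) :
    Sat α A.ex ↔ ∃ a : Tm 0, a.NoNoema ∧ Sat α (A.inst a) := by
  simp [Fm.ex, Fm.inst]

theorem sat_mem_abs (a : Tm 0) (A : Fm 1) :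
    Sat α (Fm.mem a (.abs A)) ↔ Settled α (A.inst a) := by
  rw [sat_mem, MemAt]

@[simp] theorem sat_tr (A : Fm 0) : Sat α A.tr ↔ Settled α A := by
  have h : ∀ y : Tm 0, (A.lift.lift.subst (ups fun _ => y)).inst y = A := fun y => by
    rw [Fm.subst_ups_inst, Fm.lift_subst_cons]
    have := Fm.lift_subst_cons A y Fin.elim0
    rw [Fm.subst_closed] at this
    convert this using 2
    funext i
    rw [Subsingleton.elim i 0, Fin.cons_zero]
  simp only [Fm.tr, sat_ex, Fm.inst, Fm.subst_mem, Tm.subst_abs, Tm.subst_bound_apply]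
  constructor
  · rintro ⟨y, -, hy⟩
    rwa [sat_mem_abs, h] at hy
  · intro hA
    refine ⟨.alethizor, by simp [Tm.NoNoema], ?_⟩
    rwa [sat_mem_abs, h]

theorem settled_zero (A : Fm 0) : ¬ Settled 0 A := by
  rintro ⟨β, hβ, -⟩
  exact absurd hβ (not_lt.2 zero_le)

theorem settled_succ (A : Fm 0) : Settled (α + 1) A ↔ Sat α A := by
  rw [← Order.succ_eq_add_one]
  constructor
  · rintro ⟨β, hβ, h⟩
    exact h α (Order.lt_succ_iff.1 hβ) (Order.lt_succ α)
  · intro h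
    refine ⟨α, Order.lt_succ α, fun γ h1 h2 => ?_⟩
    rwa [le_antisymm (Order.lt_succ_iff.1 h2) h1]

theorem settled_of_forall {A : Fm 0} (h0 : α ≠ 0) (h : ∀ γ, Sat γ A) : Settled α A :=
  ⟨0, (pos_iff_ne_zero.2 h0), fun γ _ _ => h γ⟩

theorem Settled.mp {A B : Fm 0} (h : Settled α (A.imp B)) (hA : Settled α A) : Settled α B := by
  obtain ⟨β, hβ, h1⟩ := h
  obtain ⟨β', hβ', h2⟩ := hA
  refine ⟨max β β', max_lt hβ hβ', fun γ h3 h4 => ?_⟩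
  exact (sat_imp A B).1 (h1 γ ((le_max_left _ _).trans h3) h4)
    (h2 γ ((le_max_right _ _).trans h3) h4)

end

/-! ### Identity at a stage -/

section
variable {E : Fm 0 → Prop} {a b c : Tm 0}

theorem Ident.refl (E : Fm 0 → Prop) (a : Tm 0) : Ident E a a := fun _ _ => Iff.rfl

theorem Ident.symm (h : Ident E a b) : Ident E b a := fun B hB => (h B hB).symm

theorem Ident.trans (h : Ident E a b) (h' : Ident E b c) : Ident E a c :=
  fun B hB => (h B hB).trans (h' B hB)

theorem noNoema_bound {k : ℕ} (i : Fin k) : (Tm.bound i).NoNoema := by simp [Tm.NoNoema]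

/-- A context in one variable around identical cognomina yields identical cognomina. -/
theorem Ident.subst (h : Ident E a b) {t : Tm 1} (ht : t.NoNoema) :
    Ident E (t.subst fun _ => a) (t.subst fun _ => b) := by
  intro B hB
  have h1 := h (B.subst fun _ => t) (hB.subst fun _ => ht)
  simpa [Fm.inst, Fm.subst_subst] using h1

/-- Membership respects identity of the member: in `{u | B}` by the definition of identity, in the
alethizor and the enumerator since their members are specified up to identity. -/
theorem memAt_congr_left (h : Ident E a b) :
    ∀ u : Tm 0, u.NoNoema → (MemAt E a u ↔ MemAt E b u)
  | .bound i, _ => i.elim0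
  | .noema _, hu => by simp [Tm.NoNoema] at hu
  | .alethizor, _ => by
    simp only [MemAt]
    exact exists_congr fun A => and_congr_left fun _ => ⟨h.symm.trans, h.trans⟩
  | .enumerator, _ => by
    simp only [MemAt]
    exact exists_congr fun n => exists_congr fun b =>
      and_congr_right fun _ => and_congr_left fun _ => ⟨h.symm.trans, h.trans⟩
  | .junct b c, hu => by
    simp only [Tm.NoNoema] at hu
    simp only [MemAt, memAt_congr_left h b hu.1, memAt_congr_left h c hu.2]
  | .abs A, hu => by
    simp only [Tm.NoNoema] at hu
    simpa only [MemAt] using h A hu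

/-- Substituting identical cognomina with the same members into a term in one variable preserves
the members. -/
theorem memAt_congr_subst (h : Ident E a b) (ha : a.NoNoema) (hb : b.NoNoema)
    (hmem : ∀ x : Tm 0, x.NoNoema → (MemAt E x a ↔ MemAt E x b)) {x : Tm 1} (hx : x.NoNoema) :
    ∀ u : Tm 1, u.NoNoema →
      (MemAt E (x.subst fun _ => a) (u.subst fun _ => a) ↔
        MemAt E (x.subst fun _ => b) (u.subst fun _ => b))
  | .bound i, _ => by
    simp only [Tm.subst]
    exact (memAt_congr_left (h.subst hx) a ha).trans (hmem _ (hx.subst fun _ => hb))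
  | .noema _, hu => by simp [Tm.NoNoema] at hu
  | .alethizor, hu => by
    simpa only [Tm.subst] using memAt_congr_left (h.subst hx) .alethizor (by simp [Tm.NoNoema])
  | .enumerator, hu => by
    simpa only [Tm.subst] using memAt_congr_left (h.subst hx) .enumerator (by simp [Tm.NoNoema])
  | .junct c d, hu => by
    simp only [Tm.NoNoema] at hu
    simp only [Tm.subst, MemAt, memAt_congr_subst h ha hb hmem hx c hu.1,
      memAt_congr_subst h ha hb hmem hx d hu.2]
  | .abs A, hu => by
    simp only [Tm.NoNoema] at hu
    have key : ∀ c : Tm 0, (A.subst (ups fun _ => c)).inst (x.subst fun _ => c) =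
        (A.subst (Fin.cons x (fun _ => .bound 0))).inst c := by
      intro c
      rw [Fm.subst_ups_inst, Fm.inst, Fm.subst_subst]
      congr 1
      funext i
      refine Fin.cases ?_ (fun j => ?_) i <;> simp
    simp only [Tm.subst, MemAt, key]
    refine h _ (hu.subst fun i => ?_)
    refine Fin.cases ?_ (fun j => ?_) i
    · simpa using hx
    · simp [Tm.NoNoema]

/-- Substituting identical cognomina with the same members preserves truth at the stage. -/
theorem satAt_congr (h : Ident E a b) (ha : a.NoNoema) (hb : b.NoNoema)
    (hmem : ∀ x : Tm 0, x.NoNoema → (MemAt E x a ↔ MemAt E x b)) :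
    ∀ C : Fm 1, C.NoNoema → (SatAt E (C.inst a) ↔ SatAt E (C.inst b)) := by
  suffices H : ∀ (n : ℕ) (C : Fm 1), C.depth < n → C.NoNoema →
      (SatAt E (C.inst a) ↔ SatAt E (C.inst b)) from
    fun C => H _ C (Nat.lt_succ_self _)
  intro n
  induction n with
  | zero => intro C hC; exact absurd hC (Nat.not_lt_zero _)
  | succ n ih =>
    intro C hn hC
    cases C with
    | app u x =>
      simp only [Fm.NoNoema] at hC
      have := memAt_congr_subst h ha hb hmem hC.2 u hC.1
      simpa only [Fm.inst, Fm.subst, SatAt] using this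
    | joint A B =>
      simp only [Fm.NoNoema] at hC
      simp only [Fm.depth] at hn
      have h1 := ih A (by omega) hC.1
      have h2 := ih B (by omega) hC.2
      simp only [Fm.inst, Fm.subst] at h1 h2 ⊢
      rw [satAt_joint, satAt_joint, h1, h2]
    | all A =>
      simp only [Fm.NoNoema] at hC
      simp only [Fm.depth] at hn
      have key : ∀ c d : Tm 0, (A.subst (ups fun _ => c)).inst d =
          (A.subst (Fin.cons (d.rename Fin.elim0) (fun _ => .bound 0))).inst c := by
        intro c d
        rw [Fm.subst_ups_inst, Fm.inst, Fm.subst_subst]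
        congr 1
        funext i
        refine Fin.cases ?_ (fun j => ?_) i
        · simp [Tm.rename_subst]
        · simp
      simp only [Fm.inst, Fm.subst]
      rw [satAt_all, satAt_all]
      refine forall_congr' fun d => forall_congr' fun hd => ?_
      rw [key, key]
      refine ih _ (by rw [Fm.depth_subst]; omega) (hC.subst fun i => ?_)
      refine Fin.cases ?_ (fun j => ?_) i
      · simpa using hd.rename _
      · simp [Tm.NoNoema]

end

section
variable {k : ℕ}

@[simp] theorem noNoema_mem (a b : Tm k) : (Fm.mem a b).NoNoema ↔ a.NoNoema ∧ b.NoNoema := by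
  simp [Fm.mem, Fm.NoNoema, and_comm]

@[simp] theorem noNoema_or (A B : Fm k) : (A.or B).NoNoema ↔ A.NoNoema ∧ B.NoNoema := by
  simp [Fm.or, Fm.NoNoema]

@[simp] theorem noNoema_imp (A B : Fm k) : (A.imp B).NoNoema ↔ A.NoNoema ∧ B.NoNoema := by
  simp [Fm.imp, Fm.NoNoema]

@[simp] theorem noNoema_neg (A : Fm k) : A.neg.NoNoema ↔ A.NoNoema := by
  simp [Fm.neg, Fm.NoNoema]

theorem Fm.NoNoema.tr {A : Fm k} (h : A.NoNoema) : A.tr.NoNoema := by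
  simp [Fm.tr, Fm.ex, Fm.NoNoema, Tm.NoNoema, h.lift.lift]

theorem noNoema_eq {a b : Tm k} (ha : a.NoNoema) (hb : b.NoNoema) : (Fm.eq a b).NoNoema := by
  simp [Fm.eq, Fm.NoNoema, Tm.NoNoema, ha.lift, hb.lift]

end

@[simp] theorem Fm.inst_lift (A : Fm 0) (a : Tm 0) : A.lift.inst a = A := by
  rw [Fm.inst_eq, Fm.lift_subst_cons, Fm.subst_closed]

@[simp] theorem Tm.lift_subst (a : Tm 0) (s : Fin 1 → Tm 0) : a.lift.subst s = a := by
  simp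

section
variable {α : Ordinal.{0}}

theorem sat_eq_iff_forall (a b : Tm 0) : Sat α (Fm.eq a b) ↔
    ∀ u : Tm 0, u.NoNoema → MemAt (Settled α) a u → MemAt (Settled α) b u := by
  simp [Fm.eq, Fm.inst, sat_mem]

/-- Identity is expressed by the formula `a = b`. Membership in `{u | B}` gives one half of the
defining equivalence, and membership in `{u | B(u) → B(a)}` the other half. -/
theorem sat_eq {a b : Tm 0} (ha : a.NoNoema) :
    Sat α (Fm.eq a b) ↔ Ident (Settled α) a b := by
  rw [sat_eq_iff_forall]
  constructor
  · intro h
    have h1 : ∀ B : Fm 1, B.NoNoema → Settled α (B.inst a) → Settled α (B.inst b) := by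
      intro B hB hs
      have := h (.abs B) (by simpa [Tm.NoNoema] using hB)
      simp only [MemAt] at this
      exact this hs
    refine fun B hB => ⟨h1 B hB, fun hb => ?_⟩
    have h0 : α ≠ 0 := by
      rintro rfl
      exact settled_zero _ hb
    have h2 := h1 (B.imp (B.inst a).lift) (by simp [hB, (hB.inst ha).lift])
    have e : ∀ c, (B.imp (B.inst a).lift).inst c = (B.inst c).imp (B.inst a) := by
      intro c
      have := Fm.inst_lift (B.inst a) c
      simp only [Fm.inst, Fm.subst_imp] at this ⊢
      rw [this]
    rw [e, e] at h2
    exact (h2 (settled_of_forall h0 fun γ => by simp)).mp hb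
  · intro h u hu
    exact (memAt_congr_left h u hu).1

/-- Identity at a successor stage implies identity at its predecessor, as `𝕋 B` holds at the
predecessor exactly when `B` is settled there. -/
theorem ident_of_ident_succ {a b : Tm 0} (h : Ident (Settled (α + 1)) a b) :
    Ident (Settled α) a b := by
  intro B hB
  have := h B.tr hB.tr
  simpa only [settled_succ, Fm.inst, Fm.subst_tr, sat_tr] using this

/-- Since `a = a` is always settled, substituting an identical cognomen `b` on the right settles
`a = b`. -/
theorem settled_eq_of_ident {a b : Tm 0} (ha : a.NoNoema) (h0 : α ≠ 0)
    (h : Ident (Settled α) a b) : Settled α (Fm.eq a b) := by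
  have h1 := h (Fm.eq a.lift (.bound 0)) (noNoema_eq ha.lift (noNoema_bound 0))
  have e : ∀ c, (Fm.eq a.lift (.bound 0)).inst c = Fm.eq a c := by
    intro c
    simp [Fm.inst]
  rw [e, e] at h1
  exact h1.1 (settled_of_forall h0 fun γ => (sat_eq ha).2 (Ident.refl _ a))

/-- Identity can only be lost in the course of the process. -/
theorem Ident.of_le {a b : Tm 0} (ha : a.NoNoema) {γ δ : Ordinal.{0}} (hγ : γ ≤ δ)
    (h : Ident (Settled δ) a b) : Ident (Settled γ) a b := by
  induction δ using Ordinal.limitRecOn with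
  | zero => rwa [nonpos_iff_eq_zero.1 hγ]
  | add_one δ ih =>
    rcases hγ.eq_or_lt with rfl | hlt
    · exact h
    · exact ih (Order.lt_add_one_iff.1 hlt) (ident_of_ident_succ h)
  | limit δ hδ ih =>
    rcases hγ.eq_or_lt with rfl | hlt
    · exact h
    · have h0 : δ ≠ 0 := (pos_of_gt hlt).ne'
      -- `a = b` is settled at `δ`, hence holds at some stage between `γ` and `δ`.
      obtain ⟨β, hβ, hs⟩ := settled_eq_of_ident ha h0 h
      exact ih (max β γ) (max_lt hβ hlt) (le_max_right _ _)
        ((sat_eq ha).1 (hs _ (le_max_left _ _) (max_lt hβ hlt)))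

end

/-! ### Variants are identical at every stage -/

theorem VarT.noNoema : ∀ {a b : Tm 0}, VarT a b → a.NoNoema ∧ b.NoNoema
  | _, _, .alethizor => by simp [Tm.NoNoema]
  | _, _, .enumerator => by simp [Tm.NoNoema]
  | _, _, .junct _ _ _ _ h1 h2 => by
    simp only [Tm.NoNoema]
    exact ⟨⟨h1.noNoema.1, h2.noNoema.1⟩, h1.noNoema.2, h2.noNoema.2⟩
  | _, _, .swap _ _ _ _ h1 h2 => by
    simp only [Tm.NoNoema]
    exact ⟨⟨h1.noNoema.1, h2.noNoema.1⟩, h2.noNoema.2, h1.noNoema.2⟩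
  | _, _, .abs _ _ hA hB _ => by
    simpa only [Tm.NoNoema] using ⟨hA, hB⟩

theorem VarT.refl : ∀ {a : Tm 0}, a.NoNoema → VarT a a
  | .bound i, _ => i.elim0
  | .noema _, h => by simp [Tm.NoNoema] at h
  | .alethizor, _ => .alethizor
  | .enumerator, _ => .enumerator
  | .junct a b, h => by
    simp only [Tm.NoNoema] at h
    exact .junct _ _ _ _ (VarT.refl h.1) (VarT.refl h.2)
  | .abs A, h => by
    simp only [Tm.NoNoema] at h
    exact .abs _ _ h h fun d hd => .congruent _ _ (h.inst hd) (h.inst hd) fun _ _ => Iff.rfl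

section
variable {E : Fm 0 → Prop}

/-- Variants have the same members. In the case of `{x | A(x)}` and `{y | B(y)}` this is the assumption
on `E`, so that no induction on the variance of the propositions `A(d)` and `B(d)` is needed. -/
theorem memAt_iff_of_varT (hE : ∀ A B, VarF A B → (E A ↔ E B)) :
    ∀ {a b : Tm 0}, VarT a b → ∀ x : Tm 0, x.NoNoema → (MemAt E x a ↔ MemAt E x b)
  | _, _, .alethizor, _, _ => Iff.rfl
  | _, _, .enumerator, _, _ => Iff.rfl
  | _, _, .junct _ _ _ _ h1 h2, x, hx => by
    simp only [MemAt, memAt_iff_of_varT hE h1 x hx, memAt_iff_of_varT hE h2 x hx]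
  | _, _, .swap _ _ _ _ h1 h2, x, hx => by
    simp only [MemAt, memAt_iff_of_varT hE h1 x hx, memAt_iff_of_varT hE h2 x hx]
    exact and_comm
  | _, _, .abs _ _ _ _ h, x, hx => by
    simpa only [MemAt] using hE _ _ (h x hx)

theorem ident_of_varT (hE : ∀ A B, VarF A B → (E A ↔ E B)) {a b : Tm 0} (h : VarT a b) :
    Ident E a b := fun C hC => hE _ _ (.replace C a b hC h)

theorem satAt_iff_of_varF (hE : ∀ A B, VarF A B → (E A ↔ E B)) :
    ∀ {A B : Fm 0}, VarF A B → (SatAt E A ↔ SatAt E B)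
  | _, _, .congruent _ _ _ _ h => h _ (classicalVal_satAt E)
  | _, _, .replace C _ _ hC h => satAt_congr (ident_of_varT hE h) h.noNoema.1 h.noNoema.2
      (memAt_iff_of_varT hE h) C hC
  | _, _, .trans _ _ _ h1 h2 => (satAt_iff_of_varF hE h1).trans (satAt_iff_of_varF hE h2)

end

theorem settled_iff_of_sat_iff {α : Ordinal.{0}} {A B : Fm 0}
    (h : ∀ γ < α, (Sat γ A ↔ Sat γ B)) : Settled α A ↔ Settled α B :=
  exists_congr fun _ => and_congr_right fun _ => forall_congr' fun γ =>
    forall_congr' fun _ => forall_congr' fun hγ => h γ hγ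

theorem sat_iff_of_varF (α : Ordinal.{0}) : ∀ A B, VarF A B → (Sat α A ↔ Sat α B) := by
  induction α using WellFoundedLT.induction with
  | _ α ih =>
    intro A B h
    rw [sat_iff_satAt, sat_iff_satAt]
    exact satAt_iff_of_varF
      (fun A B h => settled_iff_of_sat_iff fun γ hγ => ih γ hγ A B h) h

theorem VarT.ident {a b : Tm 0} (h : VarT a b) (α : Ordinal.{0}) : Ident (Settled α) a b :=
  ident_of_varT (fun A B h => settled_iff_of_sat_iff fun γ _ => sat_iff_of_varF γ A B h) h

/-! ### The noemata name all cognomina -/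

theorem lt_cat_right {m n : ℕ} (hm : 0 < m) : n < cat m n := by
  have : 0 < m * 2 ^ n.size := by positivity
  rw [cat]; omega

theorem lt_cat_left {m n : ℕ} (hn : 0 < n) : m < cat m n := by
  have : m ≤ m * 2 ^ n.size := Nat.le_mul_of_pos_right _ (by positivity)
  rw [cat]; omega

mutual
  theorem Tm.code_pos : ∀ {k : ℕ} (a : Tm k), 0 < a.code
    | _, .bound _ => by simp [Tm.code]
    | _, .noema _ => by simp [Tm.code]
    | _, .alethizor => by simp [Tm.code]
    | _, .enumerator => by simp [Tm.code]
    | _, .junct a b => by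
      rw [Tm.code]
      exact (Nat.zero_le _).trans_lt (lt_cat_right (by norm_num))
    | _, .abs A => by
      rw [Tm.code]
      exact (Nat.zero_le _).trans_lt (lt_cat_right (by norm_num))
  theorem Fm.code_pos : ∀ {k : ℕ} (A : Fm k), 0 < A.code
    | _, .app b a => by
      rw [Fm.code]
      exact (Nat.zero_le _).trans_lt (lt_cat_right b.code_pos)
    | _, .joint A B => by
      rw [Fm.code]
      exact (Nat.zero_le _).trans_lt (lt_cat_right (by norm_num))
    | _, .all A => by
      rw [Fm.code]
      exact (Nat.zero_le _).trans_lt (lt_cat_right (by norm_num))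
end

/-- Only finitely many expressions have a number below a given bound, since the number of an
expression exceeds the numbers of its parts. -/
theorem finite_code_le (N : ℕ) : ∀ k : ℕ,
    {a : Tm k | a.code ≤ N}.Finite ∧ {A : Fm k | A.code ≤ N}.Finite := by
  induction N with
  | zero =>
    refine fun k => ⟨Set.finite_empty.subset fun a ha => ?_, Set.finite_empty.subset fun A hA => ?_⟩
    · exact absurd ha (not_le.2 a.code_pos)
    · exact absurd hA (not_le.2 A.code_pos)
  | succ N ih =>
    intro k
    constructor
    · have hfin := (((Set.finite_range (fun i : Fin k => Tm.bound i)).union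
        ((Set.finite_Iic (N + 1)).image (fun n => (Tm.noema n : Tm k)))).union
        (Set.toFinite {(Tm.alethizor : Tm k), Tm.enumerator})).union
        ((((ih k).1.image2 Tm.junct (ih k).1)).union ((ih (k + 1)).2.image Tm.abs))
      refine hfin.subset fun a ha => ?_
      cases a with
      | bound i => exact .inl (.inl (.inl ⟨i, rfl⟩))
      | noema n =>
        refine .inl (.inl (.inr ⟨n, ?_, rfl⟩))
        simp only [Set.mem_ofPred_eq, Tm.code] at ha
        have : 2 * n + 6 < 2 ^ (2 * n + 6) := Nat.lt_two_pow_self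
        rw [Set.mem_Iic]; omega
      | alethizor => exact .inl (.inr (.inl rfl))
      | enumerator => exact .inl (.inr (.inr rfl))
      | junct a b =>
        simp only [Set.mem_ofPred_eq, Tm.code] at ha
        have h0 : cat a.code b.code < cat (2 ^ 5) (cat a.code b.code) := lt_cat_right (by norm_num)
        have h1 : a.code < cat a.code b.code := lt_cat_left b.code_pos
        have h2 : b.code < cat a.code b.code := lt_cat_right a.code_pos
        exact .inr (.inl ⟨a, show a.code ≤ N by omega, b, show b.code ≤ N by omega, rfl⟩)
      | abs A =>
        simp only [Set.mem_ofPred_eq, Tm.code] at ha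
        have h0 : A.code < cat (2 ^ 0) A.code := lt_cat_right (by norm_num)
        exact .inr (.inr ⟨A, show A.code ≤ N by omega, rfl⟩)
    · have hfin := ((ih k).1.image2 Fm.app (ih k).1).union
        (((ih k).2.image2 Fm.joint (ih k).2).union ((ih (k + 1)).2.image Fm.all))
      refine hfin.subset fun A hA => ?_
      cases A with
      | app b a =>
        simp only [Set.mem_ofPred_eq, Fm.code] at hA
        have h1 : b.code < cat b.code a.code := lt_cat_left a.code_pos
        have h2 : a.code < cat b.code a.code := lt_cat_right b.code_pos
        exact .inl ⟨b, show b.code ≤ N by omega, a, show a.code ≤ N by omega, rfl⟩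
      | joint A B =>
        simp only [Set.mem_ofPred_eq, Fm.code] at hA
        have h0 : cat A.code B.code < cat (2 ^ 2) (cat A.code B.code) := lt_cat_right (by norm_num)
        have h1 : A.code < cat A.code B.code := lt_cat_left B.code_pos
        have h2 : B.code < cat A.code B.code := lt_cat_right A.code_pos
        exact .inr (.inl ⟨A, show A.code ≤ N by omega, B, show B.code ≤ N by omega, rfl⟩)
      | all A =>
        simp only [Set.mem_ofPred_eq, Fm.code] at hA
        have h0 : A.code < cat (2 ^ 1) A.code := lt_cat_right (by norm_num)
        exact .inr (.inr ⟨A, show A.code ≤ N by omega, rfl⟩)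

theorem enum_spec {n : ℕ}
    (h : {c : Tm 0 | c.NoNoema ∧ ∀ m, m < n → ¬ VarT (enum m) c}.Nonempty) :
    (enum n).NoNoema ∧ (∀ m < n, ¬ VarT (enum m) (enum n)) ∧
      ∀ c : Tm 0, c.NoNoema → (∀ m < n, ¬ VarT (enum m) c) → (enum n).code ≤ c.code := by
  have e : enum n = Function.argminOn Tm.code _ h := by
    rw [enum, dif_pos h]
  have h1 := Function.argminOn_mem Tm.code _ h
  rw [← e] at h1
  refine ⟨h1.1, h1.2, fun c hc hm => ?_⟩
  rw [e]
  have hcm : c ∈ {c : Tm 0 | c.NoNoema ∧ ∀ m, m < n → ¬ VarT (enum m) c} := ⟨hc, hm⟩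
  exact Function.argminOn_le Tm.code _ hcm

theorem noNoema_enum (n : ℕ) : (enum n).NoNoema := by
  by_cases h : {c : Tm 0 | c.NoNoema ∧ ∀ m, m < n → ¬ VarT (enum m) c}.Nonempty
  · exact (enum_spec h).1
  · rw [enum, dif_neg h]
    simp [Tm.NoNoema]

/-- A cognomen without a variant in the enumeration would bound the numbers of all the infinitely
many cognomina enumerated. -/
theorem exists_varT_enum {c : Tm 0} (hc : c.NoNoema) : ∃ n, VarT (enum n) c := by
  by_contra! hne
  have hspec := fun n => enum_spec (n := n) ⟨c, hc, fun m _ => hne m⟩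
  have hinj : Function.Injective enum := by
    have key : ∀ m n, m < n → enum m ≠ enum n := fun m n hmn he =>
      (hspec n).2.1 m hmn (he ▸ VarT.refl (noNoema_enum m))
    intro m n he
    rcases lt_trichotomy m n with h | h | h
    · exact absurd he (key m n h)
    · exact h
    · exact absurd he.symm (key n m h)
  refine Set.infinite_range_of_injective hinj ((finite_code_le c.code 0).1.subset ?_)
  rintro _ ⟨n, rfl⟩
  exact (hspec n).2.2 c hc fun m _ => hne m

section
variable (E : Fm 0 → Prop)

/-- Either `vₙ₊₁` names something new, or its candidate already has a name. -/
theorem naming_succ_cases (n : ℕ) :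
    (naming E (n + 1) = enum (n + 1) ∧ ∀ m ≤ n, ¬ Ident E (naming E m) (enum (n + 1))) ∨
      (naming E (n + 1) = naming E n ∧ ∃ m ≤ n, Ident E (naming E m) (enum (n + 1))) := by
  by_cases h : ∀ m, (_ : m ≤ n) → ¬ Ident E (naming E m) (enum (n + 1))
  · refine .inl ⟨?_, h⟩
    rw [naming, if_pos h]
  · refine .inr ⟨?_, by push Not at h; simpa using h⟩
    rw [naming, if_neg h]

theorem noNoema_naming (n : ℕ) : (naming E n).NoNoema := by
  induction n with
  | zero => rw [naming]; exact noNoema_enum 0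
  | succ n ih =>
    rcases naming_succ_cases E n with ⟨h, -⟩ | ⟨h, -⟩ <;> rw [h]
    · exact noNoema_enum _
    · exact ih

theorem exists_ident_naming_enum (n : ℕ) : ∃ m, Ident E (naming E m) (enum n) := by
  cases n with
  | zero => exact ⟨0, by rw [naming]; exact Ident.refl _ _⟩
  | succ n =>
    rcases naming_succ_cases E n with ⟨h, -⟩ | ⟨-, m, -, h⟩
    · exact ⟨n + 1, by rw [h]; exact Ident.refl _ _⟩
    · exact ⟨m, h⟩

/-- The noemata that name a given cognomen, up to identity, form an interval. -/
theorem Ident.naming_of_le_of_le {i j l : ℕ} (hij : i ≤ j) (hjl : j ≤ l)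
    (h : Ident E (naming E i) (naming E l)) : Ident E (naming E i) (naming E j) := by
  induction l, hjl using Nat.le_induction with
  | base => exact h
  | succ l hl ih =>
    rcases naming_succ_cases E l with ⟨e, hne⟩ | ⟨e, -⟩
    · rw [e] at h
      exact absurd h (hne i (hij.trans hl))
    · rw [e] at h
      exact ih h

end

theorem exists_ident_naming (α : Ordinal.{0}) {c : Tm 0} (hc : c.NoNoema) :
    ∃ m, Ident (Settled α) (naming (Settled α) m) c := by
  obtain ⟨n, hn⟩ := exists_varT_enum hc
  obtain ⟨m, hm⟩ := exists_ident_naming_enum (Settled α) n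
  exact ⟨m, hm.trans (hn.ident α)⟩

/-- The naming depends only on the identity of cognomina. -/
theorem naming_congr {E E' : Fm 0 → Prop}
    (h : ∀ a b : Tm 0, a.NoNoema → b.NoNoema → (Ident E a b ↔ Ident E' a b)) (n : ℕ) :
    naming E n = naming E' n := by
  induction n using Nat.strong_induction_on with
  | _ n ih =>
    cases n with
    | zero => rw [naming, naming]
    | succ n =>
      have e : (∀ m, (_ : m ≤ n) → ¬ Ident E (naming E m) (enum (n + 1))) ↔
          ∀ m, (_ : m ≤ n) → ¬ Ident E' (naming E' m) (enum (n + 1)) :=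
        forall_congr' fun m => forall_congr' fun hm => by
          rw [ih m (by omega), h _ _ (noNoema_naming _ _) (noNoema_enum _)]
      rw [naming, naming, ih n (by omega)]
      by_cases h1 : ∀ m, (_ : m ≤ n) → ¬ Ident E (naming E m) (enum (n + 1))
      · rw [if_pos h1, if_pos (e.1 h1)]
      · rw [if_neg h1, if_neg fun h2 => h1 (e.2 h2)]

/-! ### The closure ordinal -/

theorem noNoema_designate_naming {k : ℕ} (E : Fm 0 → Prop) (A : Fm k) :
    (A.designate (naming E)).NoNoema := Fm.noNoema_designate (noNoema_naming E) A

theorem mem_trueAt {γ : Ordinal.{0}} {A : Fm 0} :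
    A ∈ TrueAt γ ↔ Settled γ (A.designate (naming (Settled γ))) := by
  simp [TrueAt, Holds]

/-- Set-many properties that hold from some stage on hold from a common stage on. -/
theorem exists_forall_of_forall_exists {ι : Type} {p : ι → Ordinal.{0} → Prop}
    (h : ∀ i, ∃ β, ∀ γ, β ≤ γ → p i γ) : ∃ β, ∀ i γ, β ≤ γ → p i γ := by
  choose f hf using h
  exact ⟨⨆ i, f i, fun i γ hγ => hf i γ ((Ordinal.le_iSup f i).trans hγ)⟩

/-- As identity can only be lost, it is constant from some stage on. -/
theorem exists_ident_const : ∃ β : Ordinal.{0}, ∀ γ, β ≤ γ → ∀ a b : Tm 0, a.NoNoema →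
    (Ident (Settled γ) a b ↔ Ident (Settled β) a b) := by
  have h : ∀ i : Tm 0 × Tm 0, ∃ β : Ordinal.{0}, ∀ γ, β ≤ γ → i.1.NoNoema →
      (Ident (Settled γ) i.1 i.2 → ∀ δ, Ident (Settled δ) i.1 i.2) := by
    rintro ⟨a, b⟩
    by_cases h : ∃ β : Ordinal.{0}, ¬ Ident (Settled β) a b
    · obtain ⟨β, hβ⟩ := h
      exact ⟨β, fun γ hγ ha hi => absurd (hi.of_le ha hγ) hβ⟩
    · push Not at h
      exact ⟨0, fun _ _ _ _ => h⟩
  obtain ⟨β, hβ⟩ := exists_forall_of_forall_exists h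
  exact ⟨β, fun γ hγ a b ha => ⟨fun hi => hβ (a, b) γ hγ ha hi β,
    fun hi => hβ (a, b) β le_rfl ha hi γ⟩⟩

/-- Past the stage at which identity and all the stable propositions have become constant, there is
an ordinal below which every proposition that is not stably true fails cofinally often. -/
theorem exists_stabilizes : ∃ κ, Stabilizes κ := by
  obtain ⟨β₀, h₀⟩ := exists_ident_const
  -- `β₁` and `β₂` bound the stages at which the stably true and stably false propositions settle.
  obtain ⟨β₁, h₁⟩ := exists_forall_of_forall_exists (ι := Fm 0)
    (p := fun X γ => (∃ β, ∀ δ, β ≤ δ → Sat δ X) → Sat γ X) fun X => by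
      by_cases h : ∃ β, ∀ δ, β ≤ δ → Sat δ X
      · obtain ⟨β, hβ⟩ := h
        exact ⟨β, fun γ hγ _ => hβ γ hγ⟩
      · exact ⟨0, fun _ _ h' => absurd h' h⟩
  obtain ⟨β₂, h₂⟩ := exists_forall_of_forall_exists (ι := Fm 0)
    (p := fun X γ => (∃ β, ∀ δ, β ≤ δ → ¬ Sat δ X) → ¬ Sat γ X) fun X => by
      by_cases h : ∃ β, ∀ δ, β ≤ δ → ¬ Sat δ X
      · obtain ⟨β, hβ⟩ := h
        exact ⟨β, fun γ hγ _ => hβ γ hγ⟩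
      · exact ⟨0, fun _ _ h' => absurd h' h⟩
  -- Above each `β` there is a `β'` such that every proposition that is not stably true fails between.
  have hstep : ∀ β : Ordinal.{0}, ∃ β', β < β' ∧ ∀ X : Fm 0, (¬ ∃ β, ∀ δ, β ≤ δ → Sat δ X) →
      ∃ γ, β ≤ γ ∧ γ < β' ∧ ¬ Sat γ X := by
    intro β
    obtain ⟨β', h'⟩ := exists_forall_of_forall_exists (ι := Fm 0)
      (p := fun X γ => (¬ ∃ β, ∀ δ, β ≤ δ → Sat δ X) → ∃ δ, β ≤ δ ∧ δ < γ ∧ ¬ Sat δ X) fun X => by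
        by_cases h : ∃ β, ∀ δ, β ≤ δ → Sat δ X
        · exact ⟨0, fun _ _ h' => absurd h h'⟩
        · push Not at h
          obtain ⟨δ, hδ, hX⟩ := h β
          exact ⟨δ + 1, fun γ hγ _ => ⟨δ, hδ, Order.lt_add_one_iff.2 le_rfl |>.trans_le hγ, hX⟩⟩
    exact ⟨max β' (β + 1), (Order.lt_add_one_iff.2 le_rfl).trans_le (le_max_right _ _),
      fun X hX => h' X _ (le_max_left _ _) hX⟩
  choose g hg hgX using hstep
  let β := max β₀ (max β₁ β₂)
  let l : ℕ → Ordinal.{0} := fun n => g^[n] β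
  have hl : ∀ n, l (n + 1) = g (l n) := fun n => Function.iterate_succ_apply' g n β
  let κ := ⨆ n, l n
  have hlt : ∀ n, l n < κ := fun n =>
    ((hg (l n)).trans_eq (hl n).symm).trans_le (Ordinal.le_iSup l (n + 1))
  have hβκ : β < κ := hlt 0
  have hex : ∀ δ < κ, ∃ n, δ < l n := fun δ hδ => (Ordinal.lt_iSup_iff).1 hδ
  have hlim : Order.IsSuccLimit κ := by
    refine Ordinal.isSuccLimit_iff.2 ⟨(pos_of_gt hβκ).ne', ?_⟩
    refine Order.isSuccPrelimit_of_succ_lt fun δ hδ => ?_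
    obtain ⟨n, hn⟩ := hex δ hδ
    exact (Order.succ_le_of_lt hn).trans_lt (hlt n)
  have hname : ∀ γ, β ≤ γ → naming (Settled γ) = naming (Settled β) := fun γ hγ => by
    funext n
    refine naming_congr (fun a b ha _ => ?_) n
    rw [h₀ γ ((le_max_left _ _).trans hγ) a b ha, h₀ β (le_max_left _ _) a b ha]
  have htrue : ∀ γ, β ≤ γ → ∀ A, A ∈ TrueAt γ ↔
      Settled γ (A.designate (naming (Settled β))) := fun γ hγ A => by
    rw [mem_trueAt, hname γ hγ]
  have hin : ∀ A : Fm 0, A ∈ IN ↔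
      ∃ δ, ∀ γ, δ ≤ γ → Sat γ (A.designate (naming (Settled β))) := by
    refine fun A => ⟨?_, ?_⟩
    · rintro ⟨δ, hδ⟩
      refine ⟨max δ β, fun γ hγ => ?_⟩
      have h1 : γ ≤ γ + 1 := (Order.lt_add_one_iff.2 le_rfl).le
      have := hδ (γ + 1) (((le_max_left _ _).trans hγ).trans h1)
      rwa [htrue _ (((le_max_right _ _).trans hγ).trans h1), settled_succ] at this
    · rintro ⟨δ, hδ⟩
      refine ⟨max δ β + 1, fun γ hγ => ?_⟩
      have h1 : max δ β < γ := (Order.lt_add_one_iff.2 le_rfl).trans_le hγ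
      rw [htrue γ ((le_max_right _ _).trans h1.le)]
      exact ⟨_, h1, fun γ' h2 _ => hδ γ' ((le_max_left _ _).trans h2)⟩
  refine ⟨κ, ⟨hlim, fun γ hγ => ⟨fun A hA => ?_, fun A hA => ?_⟩⟩, fun A hA => ?_⟩
  · rw [hin] at hA
    rw [htrue γ (hβκ.le.trans hγ)]
    exact ⟨β, hβκ.trans_le hγ, fun δ hδ _ =>
      h₁ _ δ (((le_max_left _ _).trans (le_max_right _ _)).trans hδ) hA⟩
  · rw [htrue γ (hβκ.le.trans hγ)] at hA
    obtain ⟨δ, hδ, hs⟩ := hA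
    by_contra hun
    have hout : A ∈ OUT := by
      by_contra ho
      exact hun (.inr fun h => h.elim (fun hi => hun (.inl hi)) ho)
    obtain ⟨ε, hε⟩ := hout
    refine h₂ (A.designate (naming (Settled β))) (max δ β)
      (((le_max_right _ _).trans (le_max_right _ _)).trans (le_max_right _ _))
      ⟨max ε β, fun ζ hζ hsat => ?_⟩
      (hs _ (le_max_left _ _) (max_lt hδ (hβκ.trans_le hγ)))
    have h1 : ζ ≤ ζ + 1 := (Order.lt_add_one_iff.2 le_rfl).le
    refine hε (ζ + 1) (((le_max_left _ _).trans hζ).trans h1) ?_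
    rwa [htrue _ (((le_max_right _ _).trans hζ).trans h1), settled_succ]
  · rw [htrue κ hβκ.le] at hA
    rw [hin]
    by_contra hX
    obtain ⟨δ, hδ, hs⟩ := hA
    obtain ⟨n, hn⟩ := hex δ hδ
    obtain ⟨ε, h1, h2, h3⟩ := hgX (l n) _ hX
    exact h3 (hs ε (hn.le.trans h1) ((h2.trans_eq (hl n).symm).trans (hlt _)))

theorem stabilizes_koppa : Stabilizes koppa :=
  csInf_mem (s := {σ | Stabilizes σ}) exists_stabilizes

theorem koppa_ne_zero : koppa ≠ 0 := by
  intro h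
  have := stabilizes_koppa.1.1
  rw [h] at this
  exact this.1 isMin_bot

/-- The propositions settled at the closure ordinal are those that hold ever after. -/
theorem settled_koppa {X : Fm 0} (hX : X.NoNoema) :
    Settled koppa X ↔ ∀ γ, koppa ≤ γ → Sat γ X := by
  have htrue : ∀ γ, X ∈ TrueAt γ ↔ Settled γ X := fun γ => by
    rw [mem_trueAt, hX.designate_eq]
  obtain ⟨⟨-, hcov⟩, hstab⟩ := stabilizes_koppa
  constructor
  · intro h γ hγ
    have h1 : γ ≤ γ + 1 := (Order.lt_add_one_iff.2 le_rfl).le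
    have := (hcov (γ + 1) (hγ.trans h1)).1 (hstab ((htrue _).2 h))
    rwa [htrue, settled_succ] at this
  · intro h
    refine (htrue _).1 ((hcov koppa le_rfl).1 ⟨koppa + 1, fun γ hγ => (htrue _).2 ?_⟩)
    exact ⟨koppa, (Order.lt_add_one_iff.2 le_rfl).trans_le hγ, fun δ hδ _ => h δ hδ⟩

/-- A proposition whose truth value is constant from the closure ordinal on is settled accordingly
at each of these stages. -/
theorem settled_iff_of_const {X : Fm 0} (hX : X.NoNoema) {P : Prop}
    (h : ∀ γ, koppa ≤ γ → (Sat γ X ↔ P)) {γ : Ordinal.{0}} (hγ : koppa ≤ γ) :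
    Settled γ X ↔ P := by
  constructor
  · rintro hs
    rcases hγ.eq_or_lt with rfl | hlt
    · exact (h _ le_rfl).1 ((settled_koppa hX).1 hs _ le_rfl)
    · obtain ⟨β, hβ, hs⟩ := hs
      exact (h _ (le_max_right _ _)).1 (hs (max β koppa) (le_max_left _ _) (max_lt hβ hlt))
  · intro hP
    obtain ⟨β, hβ, hs⟩ := (settled_koppa hX).2 fun γ hγ => (h γ hγ).2 hP
    refine ⟨β, hβ.trans_le hγ, fun δ h1 _ => ?_⟩
    rcases lt_or_ge δ koppa with h2 | h2
    · exact hs δ h1 h2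
    · exact (h δ h2).2 hP

/-- Identity of cognomina at the closure ordinal, and hence at all later stages. -/
def Same (a b : Tm 0) : Prop := Ident (Settled koppa) a b

theorem ident_iff_same {a b : Tm 0} (ha : a.NoNoema) (hb : b.NoNoema) {γ : Ordinal.{0}}
    (hγ : koppa ≤ γ) : Ident (Settled γ) a b ↔ Same a b := by
  refine ⟨fun h => h.of_le ha hγ, fun h => ?_⟩
  have h1 := settled_eq_of_ident ha koppa_ne_zero h
  exact (sat_eq ha).1 ((settled_koppa (noNoema_eq ha hb)).1 h1 γ hγ)

/-- The cognomen named by `vₙ` from the closure ordinal on. -/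
noncomputable def name (n : ℕ) : Tm 0 := naming (Settled koppa) n

theorem noNoema_name (n : ℕ) : (name n).NoNoema := noNoema_naming _ n

theorem naming_eq_name {γ : Ordinal.{0}} (hγ : koppa ≤ γ) (n : ℕ) :
    naming (Settled γ) n = name n :=
  naming_congr (fun _ _ ha hb => ident_iff_same ha hb hγ) n

theorem exists_same_name {c : Tm 0} (hc : c.NoNoema) : ∃ n, Same (name n) c :=
  exists_ident_naming koppa hc

/-- The maxims are the formulas that hold at all stages from the closure ordinal on. -/
theorem maxim_iff (A : Fm 0) :
    Maxim A ↔ ∀ γ, koppa ≤ γ → Sat γ (A.designate name) := by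
  have : name = naming (Settled koppa) := rfl
  rw [Maxim, Holds, Fm.designate_tr, sat_tr, settled_koppa (noNoema_designate_naming _ A), this]

theorem sat_congr {a b : Tm 0} (ha : a.NoNoema) (hb : b.NoNoema) (h : Same a b) {C : Fm 1}
    (hC : C.NoNoema) {γ : Ordinal.{0}} (hγ : koppa ≤ γ) :
    Sat γ (C.inst a) ↔ Sat γ (C.inst b) := by
  have h1 : Ident (Settled (γ + 1)) a b :=
    (ident_iff_same ha hb (hγ.trans (Order.lt_add_one_iff.2 le_rfl).le)).2 h
  simpa only [settled_succ] using h1 C hC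

/-! ### Truth of substitution instances -/

section
variable {γ : Ordinal.{0}} {k : ℕ} (s : Fin k → Tm 0)

theorem fin_cons_one {m : ℕ} (x : Tm m) (s : Fin (k + 1) → Tm m) :
    (Fin.cons x s : Fin (k + 2) → Tm m) 1 = s 0 := rfl

theorem fin_cons_two {m : ℕ} (x : Tm m) (s : Fin (k + 2) → Tm m) :
    (Fin.cons x s : Fin (k + 3) → Tm m) 2 = s 1 := rfl

theorem sat_subst_all (A : Fm (k + 1)) : Sat γ ((Fm.all A).subst s) ↔
    ∀ a : Tm 0, a.NoNoema → Sat γ (A.subst (Fin.cons a s)) := by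
  simp only [Fm.subst_all, sat_all, Fm.subst_ups_inst]

theorem sat_subst_ex (A : Fm (k + 1)) : Sat γ (A.ex.subst s) ↔
    ∃ a : Tm 0, a.NoNoema ∧ Sat γ (A.subst (Fin.cons a s)) := by
  simp only [Fm.subst_ex, sat_ex, Fm.subst_ups_inst]

theorem sat_subst_neg (A : Fm k) : Sat γ (A.neg.subst s) ↔ ¬ Sat γ (A.subst s) := by simp

theorem sat_subst_and (A B : Fm k) :
    Sat γ ((A.and B).subst s) ↔ Sat γ (A.subst s) ∧ Sat γ (B.subst s) := by simp

theorem sat_subst_imp (A B : Fm k) :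
    Sat γ ((A.imp B).subst s) ↔ (Sat γ (A.subst s) → Sat γ (B.subst s)) := by simp

theorem sat_subst_iff (A B : Fm k) :
    Sat γ ((A.iff B).subst s) ↔ (Sat γ (A.subst s) ↔ Sat γ (B.subst s)) := by simp

end

/-! ### Pairs, numerals and the order of the names -/

theorem Same.refl (a : Tm 0) : Same a a := Ident.refl _ a

theorem Same.symm {a b : Tm 0} (h : Same a b) : Same b a := Ident.symm h

theorem Same.trans {a b c : Tm 0} (h : Same a b) (h' : Same b c) : Same a c := Ident.trans h h'

section
variable {k : ℕ} {a b : Tm k}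

theorem noNoema_upair (ha : a.NoNoema) (hb : b.NoNoema) : (Tm.upair a b).NoNoema := by
  simpa only [Tm.upair, Tm.NoNoema, noNoema_or] using
    And.intro (noNoema_eq (noNoema_bound 0) ha.lift) (noNoema_eq (noNoema_bound 0) hb.lift)

theorem noNoema_single (ha : a.NoNoema) : (Tm.single a).NoNoema := by
  simpa only [Tm.single, Tm.NoNoema] using
    noNoema_eq (noNoema_bound 0) ha.lift

theorem noNoema_pair (ha : a.NoNoema) (hb : b.NoNoema) : (Tm.pair a b).NoNoema :=
  noNoema_upair (noNoema_single ha) (noNoema_upair ha hb)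

theorem noNoema_zero : (Tm.zero : Tm k).NoNoema := by
  simpa only [Tm.zero, Tm.NoNoema, noNoema_neg] using
    noNoema_eq (noNoema_bound 0) (noNoema_bound 0)

theorem noNoema_succ (ha : a.NoNoema) : (Tm.succ a).NoNoema := by
  simpa only [Tm.succ, Tm.NoNoema, noNoema_or, noNoema_mem] using
    And.intro (And.intro (noNoema_bound (0 : Fin (k + 1))) ha.lift)
      (noNoema_eq (noNoema_bound 0) ha.lift)

theorem noNoema_numeral (n : ℕ) : (Tm.numeral n : Tm k).NoNoema := by
  induction n with
  | zero => exact noNoema_zero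
  | succ n ih => exact noNoema_succ ih

end

section
variable {γ : Ordinal.{0}} {a b c d x y z p q : Tm 0}

theorem sat_eq_iff_same (ha : a.NoNoema) (hb : b.NoNoema) (hγ : koppa ≤ γ) :
    Sat γ (Fm.eq a b) ↔ Same a b := by
  rw [sat_eq ha, ident_iff_same ha hb hγ]

/-- Membership in `{u | A}` is decided from the closure ordinal on if the instance of `A` is. -/
theorem sat_mem_abs_of_const {A : Fm 1} (hA : A.NoNoema) (hx : x.NoNoema) {P : Prop}
    (h : ∀ γ, koppa ≤ γ → (Sat γ (A.inst x) ↔ P)) (hγ : koppa ≤ γ) :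
    Sat γ (Fm.mem x (.abs A)) ↔ P := by
  rw [sat_mem_abs]
  exact settled_iff_of_const (hA.inst hx) h hγ

theorem sat_mem_congr_left (ha : a.NoNoema) (hb : b.NoNoema) (hx : x.NoNoema) (h : Same a b)
    (hγ : koppa ≤ γ) : Sat γ (Fm.mem a x) ↔ Sat γ (Fm.mem b x) := by
  have := sat_congr ha hb h (C := Fm.mem (.bound 0) x.lift)
    (by simp [noNoema_bound, hx.lift]) hγ
  simpa [Fm.inst] using this

theorem sat_mem_congr_right (ha : a.NoNoema) (hb : b.NoNoema) (hx : x.NoNoema) (h : Same a b)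
    (hγ : koppa ≤ γ) : Sat γ (Fm.mem x a) ↔ Sat γ (Fm.mem x b) := by
  have := sat_congr ha hb h (C := Fm.mem x.lift (.bound 0))
    (by simp [noNoema_bound, hx.lift]) hγ
  simpa [Fm.inst] using this

theorem sat_mem_upair (ha : a.NoNoema) (hb : b.NoNoema) (hx : x.NoNoema) (hγ : koppa ≤ γ) :
    Sat γ (Fm.mem x (Tm.upair a b)) ↔ Same x a ∨ Same x b := by
  refine sat_mem_abs_of_const (by simp [noNoema_eq, noNoema_bound, ha.lift, hb.lift]) hx
    (fun γ hγ => ?_) hγ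
  simp [Fm.inst, sat_eq_iff_same hx ha hγ, sat_eq_iff_same hx hb hγ]

theorem sat_mem_single (ha : a.NoNoema) (hx : x.NoNoema) (hγ : koppa ≤ γ) :
    Sat γ (Fm.mem x (Tm.single a)) ↔ Same x a := by
  refine sat_mem_abs_of_const (by simp [noNoema_eq, noNoema_bound, ha.lift]) hx
    (fun γ hγ => ?_) hγ
  simp [Fm.inst, sat_eq_iff_same hx ha hγ]

theorem Same.of_single_single (ha : a.NoNoema) (hb : b.NoNoema)
    (h : Same (Tm.single a) (Tm.single b)) : Same a b := by
  rw [← sat_mem_single hb ha le_rfl,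
    ← sat_mem_congr_right (noNoema_single ha) (noNoema_single hb) ha h le_rfl,
    sat_mem_single ha ha le_rfl]
  exact Same.refl a

theorem Same.mem_upair_iff (ha : a.NoNoema) (hb : b.NoNoema) (hc : c.NoNoema) (hd : d.NoNoema)
    (h : Same (Tm.upair a b) (Tm.upair c d)) (hx : x.NoNoema) :
    (Same x a ∨ Same x b) ↔ (Same x c ∨ Same x d) := by
  rw [← sat_mem_upair ha hb hx le_rfl, ← sat_mem_upair hc hd hx le_rfl]
  exact sat_mem_congr_right (noNoema_upair ha hb) (noNoema_upair hc hd) hx h le_rfl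

theorem Same.of_single_upair (ha : a.NoNoema) (hc : c.NoNoema) (hd : d.NoNoema)
    (h : Same (Tm.single a) (Tm.upair c d)) : Same c a ∧ Same d a := by
  have key : ∀ {x : Tm 0}, x.NoNoema → Same x c ∨ Same x d → Same x a := fun {x} hx hm => by
    rwa [← sat_mem_single ha hx le_rfl,
      sat_mem_congr_right (noNoema_single ha) (noNoema_upair hc hd) hx h le_rfl,
      sat_mem_upair hc hd hx le_rfl]
  exact ⟨key hc (.inl (Same.refl c)), key hd (.inr (Same.refl d))⟩

/-- Kuratowski pairs are injective up to identity. -/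
theorem same_pair_iff (ha : a.NoNoema) (hb : b.NoNoema) (hc : c.NoNoema) (hd : d.NoNoema) :
    Same (Tm.pair a b) (Tm.pair c d) ↔ Same a c ∧ Same b d := by
  constructor
  · intro h
    have hiff : ∀ {x : Tm 0}, x.NoNoema → ((Same x (Tm.single a) ∨ Same x (Tm.upair a b)) ↔
        (Same x (Tm.single c) ∨ Same x (Tm.upair c d))) := fun {x} hx =>
      Same.mem_upair_iff (noNoema_single ha) (noNoema_upair ha hb) (noNoema_single hc)
        (noNoema_upair hc hd) h hx
    have hac : Same a c := by
      rcases (hiff (noNoema_single ha)).1 (.inl (Same.refl _)) with h1 | h1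
      · exact h1.of_single_single ha hc
      · exact (h1.of_single_upair ha hc hd).1.symm
    have hbcd : Same b c ∨ Same b d := by
      rcases (hiff (noNoema_upair ha hb)).1 (.inr (Same.refl _)) with h1 | h1
      · exact .inl (h1.symm.of_single_upair hc ha hb).2
      · exact (h1.mem_upair_iff ha hb hc hd hb).1 (.inr (Same.refl b))
    have hdab : Same d a ∨ Same d b := by
      rcases (hiff (noNoema_upair hc hd)).2 (.inr (Same.refl _)) with h1 | h1
      · exact .inl (h1.symm.of_single_upair ha hc hd).2
      · exact (h1.mem_upair_iff hc hd ha hb hd).1 (.inr (Same.refl d))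
    refine ⟨hac, ?_⟩
    rcases hbcd with h1 | h1
    · rcases hdab with h2 | h2
      · exact h1.trans (hac.symm.trans h2.symm)
      · exact h2.symm
    · exact h1
  · rintro ⟨h1, h2⟩
    have e1 : Same (Tm.pair a b) (Tm.pair c b) := by
      have := Ident.subst h1 (t := Tm.pair (.bound 0) b.lift)
        (noNoema_pair (noNoema_bound 0) hb.lift)
      rwa [Tm.subst_pair, Tm.subst_pair, Tm.lift_subst, Tm.lift_subst] at this
    have e2 : Same (Tm.pair c b) (Tm.pair c d) := by
      have := Ident.subst h2 (t := Tm.pair c.lift (.bound 0))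
        (noNoema_pair hc.lift (noNoema_bound 0))
      rwa [Tm.subst_pair, Tm.subst_pair, Tm.lift_subst, Tm.lift_subst] at this
    exact e1.trans e2

/-- From the closure ordinal on, the members of a numeral are the smaller numerals. -/
theorem sat_mem_numeral (n : ℕ) (hx : x.NoNoema) (hγ : koppa ≤ γ) :
    Sat γ (Fm.mem x (Tm.numeral n)) ↔ ∃ m < n, Same x (Tm.numeral m) := by
  induction n generalizing γ with
  | zero =>
    refine sat_mem_abs_of_const (by simp [noNoema_eq, noNoema_bound]) hx (fun γ hγ => ?_) hγ
    simp [Fm.inst, sat_eq_iff_same hx hx hγ, Same.refl]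
  | succ n ih =>
    have hn := noNoema_numeral (k := 0) n
    refine sat_mem_abs_of_const (by simp [noNoema_eq, noNoema_bound, hn.lift]) hx
      (fun γ hγ => ?_) hγ
    simp only [Fm.inst, Fm.subst_or, sat_or, Fm.subst_mem, Tm.subst_bound_apply, Fm.subst_eq,
      Tm.lift_subst, ih hγ, sat_eq_iff_same hx hn hγ]
    constructor
    · rintro (⟨m, hm, h⟩ | h)
      · exact ⟨m, by omega, h⟩
      · exact ⟨n, by omega, h⟩
    · rintro ⟨m, hm, h⟩
      rcases Nat.lt_succ_iff_lt_or_eq.1 hm with h1 | rfl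
      · exact .inl ⟨m, h1, h⟩
      · exact .inr h

theorem not_same_numeral_of_lt (n : ℕ) : ∀ m, n < m → ¬ Same (Tm.numeral n) (Tm.numeral m) := by
  induction n using Nat.strong_induction_on with
  | _ n ih =>
    intro m hnm h
    have hn := noNoema_numeral (k := 0) n
    have h1 := (sat_mem_numeral m hn le_rfl).2 ⟨n, hnm, Same.refl _⟩
    rw [← sat_mem_congr_right hn (noNoema_numeral m) hn h le_rfl, sat_mem_numeral n hn le_rfl] at h1
    obtain ⟨l, hl, hs⟩ := h1
    exact ih l hl n hl hs.symm

theorem same_numeral_iff {m n : ℕ} : Same (Tm.numeral m) (Tm.numeral n) ↔ m = n := by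
  refine ⟨fun h => ?_, fun h => h ▸ Same.refl _⟩
  rcases lt_trichotomy m n with h1 | h1 | h1
  · exact absurd h (not_same_numeral_of_lt m n h1)
  · exact h1
  · exact absurd h.symm (not_same_numeral_of_lt n m h1)

theorem sat_numeral_mem_nat (n : ℕ) (h0 : γ ≠ 0) : Sat γ (Fm.mem (Tm.numeral n) Tm.nat) := by
  rw [Tm.nat, sat_mem_abs]
  refine settled_of_forall h0 fun γ => ?_
  simp only [Fm.inst, sat_subst_all, sat_subst_imp, sat_subst_and, Fm.subst_mem, Tm.subst_zero,
    Tm.subst_bound_apply, Tm.subst_succ, Fin.cons_zero, fin_cons_one]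
  rintro y - ⟨h1, h2⟩
  induction n with
  | zero => exact h1
  | succ n ih => exact h2 _ (noNoema_numeral n) ih

theorem sat_pair_mem_enumerator (hp : p.NoNoema) (hx : x.NoNoema) (hγ : koppa ≤ γ) :
    Sat γ (Fm.mem (Tm.pair p x) .enumerator) ↔
      ∃ n, Same p (Tm.numeral n) ∧ Same x (name n) := by
  rw [sat_mem, MemAt]
  simp only [naming_eq_name hγ]
  constructor
  · rintro ⟨n, b, hb, h1, h2⟩
    have hn := noNoema_numeral (k := 0) n
    rw [ident_iff_same (noNoema_pair hp hx) (noNoema_pair hn hb) hγ, same_pair_iff hp hx hn hb] at h1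
    rw [ident_iff_same hb (noNoema_name n) hγ] at h2
    exact ⟨n, h1.1, h1.2.trans h2⟩
  · rintro ⟨n, h1, h2⟩
    have hn := noNoema_numeral (k := 0) n
    refine ⟨n, x, hx, ?_, (ident_iff_same hx (noNoema_name n) hγ).2 h2⟩
    rw [ident_iff_same (noNoema_pair hp hx) (noNoema_pair hn hx) hγ, same_pair_iff hp hx hn hx]
    exact ⟨h1, Same.refl x⟩

/-- That the members of the natural numbers of the object language are decided is not needed here:
membership in the enumerator already restricts `x` and `y` in the definition of `◁` to numerals, which
are natural numbers at every stage. -/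
theorem sat_before (hx : x.NoNoema) (hz : z.NoNoema) (hγ : koppa ≤ γ) :
    Sat γ (Fm.before x z) ↔ ∃ m n, m < n ∧ Same x (name m) ∧ Same z (name n) := by
  have e : Sat γ (Fm.before x z) ↔ ∃ p : Tm 0, p.NoNoema ∧ ∃ q : Tm 0, q.NoNoema ∧
      ((Sat γ (Fm.mem p Tm.nat) ∧ Sat γ (Fm.mem q Tm.nat)) ∧
        (Sat γ (Fm.mem (Tm.pair p x) .enumerator) ∧ Sat γ (Fm.mem (Tm.pair q z) .enumerator))) ∧
          Sat γ (Fm.mem p q) := by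
    simp only [Fm.before, sat_ex, Fm.inst, sat_subst_ex, sat_subst_and, Fm.subst_mem, Tm.subst_nat,
      Tm.subst_pair, Tm.subst_enumerator, Tm.lift_subst_cons, Tm.lift_subst, Tm.subst_bound_apply,
      Fin.cons_zero, fin_cons_one]
  rw [e]
  constructor
  · rintro ⟨p, hp, q, hq, ⟨-, h1, h2⟩, h3⟩
    obtain ⟨m, hm, hxm⟩ := (sat_pair_mem_enumerator hp hx hγ).1 h1
    obtain ⟨n, hn, hzn⟩ := (sat_pair_mem_enumerator hq hz hγ).1 h2
    refine ⟨m, n, ?_, hxm, hzn⟩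
    rw [sat_mem_congr_right hq (noNoema_numeral n) hp hn hγ, sat_mem_numeral n hp hγ] at h3
    obtain ⟨l, hl, hs⟩ := h3
    rwa [same_numeral_iff.1 (hm.symm.trans hs)]
  · rintro ⟨m, n, hmn, hxm, hzn⟩
    have h0 : γ ≠ 0 := by
      rintro rfl
      exact koppa_ne_zero (nonpos_iff_eq_zero.1 hγ)
    refine ⟨Tm.numeral m, noNoema_numeral m, Tm.numeral n, noNoema_numeral n,
      ⟨⟨sat_numeral_mem_nat m h0, sat_numeral_mem_nat n h0⟩, ?_, ?_⟩, ?_⟩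
    · exact (sat_pair_mem_enumerator (noNoema_numeral m) hx hγ).2 ⟨m, Same.refl _, hxm⟩
    · exact (sat_pair_mem_enumerator (noNoema_numeral n) hz hγ).2 ⟨n, Same.refl _, hzn⟩
    · exact (sat_mem_numeral n (noNoema_numeral m) hγ).2 ⟨m, hmn, Same.refl _⟩

end

/-- The relation expressed by `x ⊴ z` from the closure ordinal on: some name of `x` comes before
some name of `z`, or `x` and `z` are identical. -/
def NamedUpTo (x z : Tm 0) : Prop :=
  (∃ m n, m < n ∧ Same x (name m) ∧ Same z (name n)) ∨ Same x z

theorem sat_beforeEq {γ : Ordinal.{0}} {x z : Tm 0} (hx : x.NoNoema) (hz : z.NoNoema)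
    (hγ : koppa ≤ γ) : Sat γ (Fm.beforeEq x z) ↔ NamedUpTo x z := by
  rw [Fm.beforeEq, sat_or, sat_before hx hz hγ, sat_eq_iff_same hx hz hγ, NamedUpTo]

/-- The order of names is antisymmetric up to identity, since the noemata that name a given
cognomen form an interval. -/
theorem NamedUpTo.antisymm {x z : Tm 0} (h1 : NamedUpTo x z) (h2 : NamedUpTo z x) : Same x z := by
  rcases h1 with ⟨m, n, hmn, hxm, hzn⟩ | h
  · rcases h2 with ⟨n', m', hnm', hzn', hxm'⟩ | h
    · have key := fun {i j l : ℕ} => Ident.naming_of_le_of_le (Settled koppa) (i := i) (j := j)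
        (l := l)
      rcases le_total m n' with h | h
      · have : Same (name m) (name n') := key h hnm'.le (hxm.symm.trans hxm')
        exact hxm.trans (this.trans hzn'.symm)
      · have : Same (name n') (name m) := key h hmn.le (hzn'.symm.trans hzn)
        exact hxm.trans (this.symm.trans hzn'.symm)
    · exact h.symm
  · exact h

/-! ### Kinds and choice -/

/-- `x` is a member of `y` at the closure ordinal. -/
def In (x y : Tm 0) : Prop := Sat koppa (Fm.mem x y)

section
variable {γ : Ordinal.{0}} {x y z a d : Tm 0}

theorem sat_kind : Sat γ (Fm.kind a) ↔ ∀ x : Tm 0, x.NoNoema →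
    Settled γ (Fm.mem x a) ∨ Settled γ (Fm.mem x a).neg := by
  simp [Fm.kind, Fm.inst]

/-- Membership in a kind is constant from the closure ordinal on. -/
theorem sat_mem_of_kind (ha : a.NoNoema) (hk : Sat koppa (Fm.kind a)) (hx : x.NoNoema)
    (hγ : koppa ≤ γ) : Sat γ (Fm.mem x a) ↔ In x a := by
  rcases sat_kind.1 hk x hx with h | h
  · rw [settled_koppa (by simp [hx, ha])] at h
    exact ⟨fun _ => h _ le_rfl, fun _ => h _ hγ⟩
  · rw [settled_koppa (by simp [hx, ha])] at h
    exact ⟨fun h1 => absurd h1 ((sat_neg _).1 (h _ hγ)),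
      fun h1 => absurd h1 ((sat_neg _).1 (h _ le_rfl))⟩

theorem sat_kind_of_const (ha : a.NoNoema) {P : Tm 0 → Prop}
    (h : ∀ x : Tm 0, x.NoNoema → ∀ γ, koppa ≤ γ → (Sat γ (Fm.mem x a) ↔ P x)) (hγ : koppa ≤ γ) :
    Sat γ (Fm.kind a) := by
  refine sat_kind.2 fun x hx => ?_
  by_cases hP : P x
  · exact .inl ((settled_iff_of_const (by simp [hx, ha]) (h x hx) hγ).2 hP)
  · refine .inr ((settled_iff_of_const (P := ¬ P x) (by simp [hx, ha]) (fun γ hγ => ?_) hγ).2 hP)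
    rw [sat_neg, h x hx γ hγ]

theorem sat_nonemptyKinds : Sat γ (Fm.nonemptyKinds d) ↔ ∀ y : Tm 0, y.NoNoema →
    Sat γ (Fm.mem y d) → Sat γ (Fm.kind y) ∧ ∃ x : Tm 0, x.NoNoema ∧ Sat γ (Fm.mem x y) := by
  simp only [Fm.nonemptyKinds, sat_all, Fm.inst, sat_subst_imp, sat_subst_and, sat_subst_ex,
    Fm.subst_mem, Fm.subst_kind, Tm.subst_bound_apply, Tm.lift_subst, Fin.cons_zero, fin_cons_one]

theorem sat_coext : Sat γ (Fm.coext a d) ↔ ∀ u : Tm 0, u.NoNoema →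
    (Sat γ (Fm.mem u a) ↔ Sat γ (Fm.mem u d)) := by
  simp only [Fm.coext, sat_all, Fm.inst, sat_subst_iff, Fm.subst_mem, Tm.subst_bound_apply,
    Tm.lift_subst]

theorem sat_disjointMembers : Sat γ (Fm.disjointMembers d) ↔ ∀ y : Tm 0, y.NoNoema →
    ∀ z : Tm 0, z.NoNoema → (Sat γ (Fm.mem y d) ∧ Sat γ (Fm.mem z d)) ∧
      ¬ Sat γ (Fm.coext y z) →
        ¬ ∃ x : Tm 0, x.NoNoema ∧ Sat γ (Fm.mem x y) ∧ Sat γ (Fm.mem x z) := by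
  simp only [Fm.disjointMembers, sat_all, Fm.inst, sat_subst_all, sat_subst_imp, sat_subst_and,
    sat_subst_ex, sat_subst_neg, Fm.subst_mem, Fm.subst_coext, Tm.subst_bound_apply, Tm.lift_subst,
    Tm.lift_subst_cons, Fin.cons_zero, fin_cons_one, fin_cons_two]

theorem sat_selects {w : Tm 0} : Sat γ (Fm.selects w d) ↔ ∀ y : Tm 0, y.NoNoema →
    Sat γ (Fm.mem y d) → ∃ x : Tm 0, x.NoNoema ∧
      (Sat γ (Fm.mem x w) ∧ Sat γ (Fm.mem x y)) ∧ ∀ z : Tm 0, z.NoNoema →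
        Sat γ (Fm.mem z w) ∧ Sat γ (Fm.mem z y) →
          Sat γ (Fm.eq z x) ∧ Sat γ (Fm.coext z x) := by
  simp only [Fm.selects, sat_all, Fm.inst, sat_subst_all, sat_subst_imp, sat_subst_and,
    sat_subst_ex, Fm.subst_mem, Fm.subst_coext, Fm.subst_eq, Tm.subst_bound_apply, Tm.lift_subst,
    Tm.lift_subst_cons, Fin.cons_zero, fin_cons_one, fin_cons_two]

theorem sat_coext_of_same (hx : x.NoNoema) (hz : z.NoNoema) (h : Same z x) (hγ : koppa ≤ γ) :
    Sat γ (Fm.coext z x) :=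
  sat_coext.2 fun _ hu => sat_mem_congr_right hz hx hu h hγ

theorem noNoema_choice (hd : d.NoNoema) : (Tm.choice d).NoNoema := by
  -- Designation turns the choice term into that of the same `d`, and its result has no noema.
  have h := Tm.designate_choice name d
  rw [hd.designate_eq] at h
  rw [← h]
  exact Tm.noNoema_designate noNoema_name _

/-- `x` is the member with the earliest name of some member of `d`. -/
def Chosen (d x : Tm 0) : Prop :=
  ∃ y : Tm 0, y.NoNoema ∧ (In y d ∧ In x y) ∧ ∀ z : Tm 0, z.NoNoema → In z y → NamedUpTo x z

/-- Membership in the choice term is constant from the closure ordinal on. -/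
theorem sat_mem_choice (hd : d.NoNoema) (hk : Sat koppa (Fm.kind d))
    (hm : Sat koppa (Fm.nonemptyKinds d)) (hx : x.NoNoema) (hγ : koppa ≤ γ) :
    Sat γ (Fm.mem x (Tm.choice d)) ↔ Chosen d x := by
  have hch := noNoema_choice hd
  rw [Tm.choice_eq] at hch ⊢
  refine sat_mem_abs_of_const (by simpa only [Tm.NoNoema] using hch) hx (fun γ hγ => ?_) hγ
  simp only [Fm.inst, sat_subst_all, sat_subst_imp, sat_subst_and, sat_subst_ex, Fm.subst_mem,
    Fm.subst_beforeEq, Tm.subst_bound_apply, Tm.lift_subst, Tm.lift_subst_cons, Fin.cons_zero,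
    fin_cons_one, fin_cons_two]
  refine exists_congr fun y => and_congr_right fun hy => ?_
  rw [sat_mem_of_kind hd hk hy hγ]
  by_cases hyd : In y d
  · have hky := (sat_nonemptyKinds.1 hm y hy hyd).1
    rw [sat_mem_of_kind hy hky hx hγ]
    refine and_congr_right fun _ => forall_congr' fun z => forall_congr' fun hz => ?_
    rw [sat_mem_of_kind hy hky hz hγ, sat_beforeEq hx hz hγ]
  · simp [hyd]

/-- A nonempty kind has a member with the earliest name. -/
theorem exists_namedUpTo (hy : y.NoNoema) (hne : ∃ x : Tm 0, x.NoNoema ∧ In x y) :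
    ∃ x : Tm 0, x.NoNoema ∧ In x y ∧ ∀ z : Tm 0, z.NoNoema → In z y → NamedUpTo x z := by
  classical
  have hname : ∀ z : Tm 0, z.NoNoema → In z y → ∃ n, Same (name n) z ∧ In (name n) y := by
    intro z hz hzy
    obtain ⟨n, hn⟩ := exists_same_name hz
    exact ⟨n, hn, (sat_mem_congr_left (noNoema_name n) hz hy hn le_rfl).2 hzy⟩
  have hex : ∃ n, In (name n) y := by
    obtain ⟨x, hx, hxy⟩ := hne
    obtain ⟨n, -, hn⟩ := hname x hx hxy
    exact ⟨n, hn⟩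
  refine ⟨name (Nat.find hex), noNoema_name _, Nat.find_spec hex, fun z hz hzy => ?_⟩
  obtain ⟨n, hs, hn⟩ := hname z hz hzy
  rcases (Nat.find_min' hex hn).eq_or_lt with h | h
  · exact .inr (h ▸ hs)
  · exact .inl ⟨_, n, h, Same.refl _, hs.symm⟩

/-- The choice term has precisely one element from each member of `d`: the one with the earliest
name. -/
theorem sat_selects_choice (hd : d.NoNoema) (hk : Sat koppa (Fm.kind d))
    (hm : Sat koppa (Fm.nonemptyKinds d)) (hdisj : Sat koppa (Fm.disjointMembers d))
    (hγ : koppa ≤ γ) : Sat γ (Fm.selects (Tm.choice d) d) := by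
  refine sat_selects.2 fun y hy hyd => ?_
  rw [sat_mem_of_kind hd hk hy hγ] at hyd
  obtain ⟨hky, hne⟩ := sat_nonemptyKinds.1 hm y hy hyd
  obtain ⟨x, hx, hxy, hmin⟩ := exists_namedUpTo hy hne
  refine ⟨x, hx, ⟨(sat_mem_choice hd hk hm hx hγ).2 ⟨y, hy, ⟨hyd, hxy⟩, hmin⟩,
    (sat_mem_of_kind hy hky hx hγ).2 hxy⟩, ?_⟩
  rintro z hz ⟨hzS, hzy⟩
  rw [sat_mem_choice hd hk hm hz hγ] at hzS
  rw [sat_mem_of_kind hy hky hz hγ] at hzy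
  obtain ⟨y', hy', ⟨hyd', hzy'⟩, hmin'⟩ := hzS
  -- The members `y` and `y'` of `d` share `z`, so they are coextensional.
  have hco : Sat koppa (Fm.coext y y') := by
    by_contra hco
    exact sat_disjointMembers.1 hdisj y hy y' hy' ⟨⟨hyd, hyd'⟩, hco⟩ ⟨z, hz, hzy, hzy'⟩
  have hzx : Same z x := (hmin' x hx ((sat_coext.1 hco x hx).1 hxy)).antisymm (hmin z hz hzy)
  exact ⟨(sat_eq_iff_same hz hx hγ).2 hzx, sat_coext_of_same hx hz hzx hγ⟩

end
end Libra

theorem mainTheorem10 (c : Libra.Tm 0)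
    (hkind : Libra.Maxim (Libra.Fm.kind c))
    (hmem : Libra.Maxim (Libra.Fm.nonemptyKinds c))
    (hdisj : Libra.Maxim (Libra.Fm.disjointMembers c)) :
    Libra.Maxim (Libra.Fm.kind (Libra.Tm.choice c)) ∧
      Libra.Maxim (Libra.Fm.selects (Libra.Tm.choice c) c) ∧
      Libra.Maxim (Libra.Fm.ex
        ((Libra.Fm.kind (.bound 0)).and (Libra.Fm.selects (.bound 0) c.lift))) := by
  open Libra in
  simp only [maxim_iff, Fm.designate_kind, Fm.designate_nonemptyKinds, Fm.designate_disjointMembers,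
    Fm.designate_selects, Tm.designate_choice, Fm.designate_ex, Fm.designate_and,
    Tm.designate_bound, Tm.designate_lift] at hkind hmem hdisj ⊢
  have hd : (c.designate name).NoNoema := Tm.noNoema_designate noNoema_name c
  have hS := noNoema_choice hd
  have h1 : ∀ γ, koppa ≤ γ → Sat γ (Fm.kind (Tm.choice (c.designate name))) := fun γ hγ =>
    sat_kind_of_const hS (fun x hx γ hγ =>
      sat_mem_choice hd (hkind _ le_rfl) (hmem _ le_rfl) hx hγ) hγ
  have h2 : ∀ γ, koppa ≤ γ → Sat γ (Fm.selects (Tm.choice (c.designate name))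
      (c.designate name)) := fun γ hγ =>
    sat_selects_choice hd (hkind _ le_rfl) (hmem _ le_rfl) (hdisj _ le_rfl) hγ
  refine ⟨h1, h2, fun γ hγ => (sat_ex _).2 ⟨_, hS, ?_⟩⟩
  simp only [Fm.inst, sat_subst_and, Fm.subst_kind, Fm.subst_selects, Tm.subst_bound_apply,
    Tm.lift_subst]
  exact ⟨h1 γ hγ, h2 γ hγ⟩
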